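/- Let $d\ge 2$ and $q_1,\dots,q_d\ge 2$ be integers. For each $j$ let $T_j$ be the homogeneous tree with all degrees $q_j+1$, with a reference vertex $o_j$ and with a horocyclic structure: its edges are oriented so that every vertex $x$ has exactly one predecessor $x^-$, while its other $q_j$ neighbours $y$ are its successors, i.e. $y^-=x$. Write $x\preccurlyeq y$ if $x$ is obtained from $y$ by going $r\ge 0$ times to the predecessor, let $\mathfrak u(x,y)$ be the number of steps from $x$ up to the maximal common ancestor of $x$ and $y$, and let $\mathfrak h(x)=\mathfrak u(x,o_j)-\mathfrak u(o_j,x)$ be the Busemann function. The graph $\mathrm{DL}=\mathrm{DL}(q_1,\dots,q_d)$ has vertex set $\{x_1\cdots x_d\in T_1\times\cdots\times T_d:\mathfrak h(x_1)+\dots+\mathfrak h(x_d)=0\}$, where $x_1\cdots x_d\sim y_1\cdots y_d$ if there are $i\ne j$ with $x_i\sim y_i$, $x_j\sim y_j$ and $x_k=y_k$ for all $k\neq i,j$. Let $P$ be the simple random walk operator $Pf(x)=\frac1{\deg (x)}\sum_{y\sim x}f(y)$ on the complex Hilbert space $\ell^2(\mathrm{DL})$, and put $D=(d-1)(q_1+\dots+q_d)$.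 For $n\ge 2$ let $B_n=\{k\in\mathbb Z^d: k_1+\dots+k_d=0,\ k_1,\dots,k_{d-1}\ge 0,\ k_d\ge -n\}$, let $\partial B_n$ be the set of $k\in B_n$ for which one of these inequalities is an equality, and $B_n^o=B_n\setminus\partial B_n$. On the space $V_0(B_n)$ of all $\psi:B_n\to\mathbb C$ with $\psi=0$ on $\partial B_n$, with the inner product of $\ell^2(B_n)$, let $Q_n\psi(k)=\frac1D\sum_{i}\sum_{j\ne i}\sqrt{q_iq_j}\,\psi(k+e_i-e_j)$ for $k\in B_n^o$ and $Q_n\psi(k)=0$ for $k\in\partial B_n$. There is an orthonormal basis $(\psi_{m,n})_{m\in B_n^o}$ of $V_0(B_n)$ with $Q_n\psi_{m,n}=\lambda_{m,n}\psi_{m,n}$; fix any such choice, for every $n\geq 2$. ($B_n^o$ is empty for $n<d$, and then $\operatorname{spec}(Q_n)=\emptyset$.) Label the edges of each $T_j$ (in any way) by $0,\dots,q_j-1$ so that the edges from any vertex to its $q_j$ successors have distinct labels. A polyhedron $S=S(a_1,\dots,a_d)$ is given by vertices $a_j\in T_j$ with $n(S):=-\sum_j\mathfrak h(a_j)\ge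 2$; its vertex set is $\{x\in \mathrm{DL}:a_j\preccurlyeq x_j\ \forall j\}$. Put $h(S)=(\mathfrak h(a_1),\dots,\mathfrak h(a_d))$. For $l\in\{1,\dots,q_j-1\}$ let $\varphi^j_l(s)=0$ for $0\le s\le l-2$, $\varphi^j_l(l-1)=\frac{q_j-l}{\sqrt{(q_j-l)(q_j+1-l)}}$ and $\varphi^j_l(s)=\frac{-1}{\sqrt{(q_j-l)(q_j+1-l)}}$ for $l\le s\le q_j-1$. For $\varphi^j:\{0,\dots,q_j-1\}\to\mathbb R$, $k\in\mathbb Z^d$ with coordinate sum $0$ and $x\in\mathrm{DL}$, put $f_k[S,\varphi^1,\dots,\varphi^d](x)=\prod_{j=1}^d f^j_{k_j}(x_j)$, where $f^j_{r}(x_j)=\varphi^j(s)\,q_j^{(\mathfrak h(a_j)-r+1)/2}$ if $r>\mathfrak h(a_j)$, $\mathfrak h(x_j)=r$ and $x_j$ has as ancestor (or is equal to) the successor of $a_j$ along the edge with label $s$, and $f^j_{r}(x_j)=0$ otherwise. Finally, for $n=n(S)$ and $m\in B_n^o$ let $$g_m[S,\varphi^1,\dots,\varphi^d]=\sum_{k\in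 B_n^o}\psi_{m,n}(k)\,f_{k+h(S)+n e_d}[S,\varphi^1,\dots,\varphi^d].$$ Then the spectrum of $P$ is pure point: the functions $g_m[S,\varphi^1_{l_1},\dots,\varphi^d_{l_d}]$, where $S$ runs through all polyhedra with $n(S)\ge2$, $m\in B_{n(S)}^o$ and $l_j\in\{1,\dots,q_j-1\}$, form an orthonormal basis of $\ell^2(\mathrm{DL})$; each of them is finitely supported, with support in $S$, and is an eigenfunction of $P$ with eigenvalue $\lambda_{m,n(S)}$. The set of eigenvalues of $P$ is $$\operatorname{spec}_p(P)=\{\lambda_{m,n}:n\ge 2,\ m\in B_n^o\}=\bigcup_{n\ge 2}\operatorname{spec}(Q_n),$$ the spectrum of $P$ is the closure of this set, and every eigenvalue of $P$ has infinite multiplicity. -/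

import Mathlib

/-! ## Homogeneous trees with a horocyclic structure -/

/-- The homogeneous tree with all degrees equal to `q + 1`, together with an orientation of its
edges in which every vertex `x` has exactly one predecessor `pred x` (all its other neighbours `y`
being successors, `pred y = x`), and with a reference vertex. Such an orientation is the same
thing as the choice of an end of the tree. -/
structure HorocyclicTree (q : ℕ) where
  /-- the vertices -/
  V : Type*
  /-- the graph -/
  graph : SimpleGraph V
  isTree : graph.IsTree
  ncard_neighborSet : ∀ x, (graph.neighborSet x).ncard = q + 1
  /-- the predecessor of a vertex -/
  pred : V → V
  adj_pred : ∀ x, graph.Adj x (pred x)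
  pred_of_adj : ∀ x y, graph.Adj x y → Xor (y = pred x) (x = pred y)
  /-- the origin -/
  root : V

namespace HorocyclicTree

variable {q : ℕ} (T : HorocyclicTree q)

/-- The ancestor relation: `x` is obtained from `y` by going to predecessors. -/
def Anc (x y : T.V) : Prop := ∃ n : ℕ, T.pred^[n] y = x

/-- The number of steps from `x` up to the maximal common ancestor of `x` and `y`. -/
noncomputable def up (x y : T.V) : ℕ := sInf {m : ℕ | T.Anc (T.pred^[m] x) y}

/-- The Busemann function (horocycle index). -/
noncomputable def hor (x : T.V) : ℤ := (T.up x T.root : ℤ) - (T.up T.root x : ℤ)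

/-- A labelling of the edges by `0, …, q - 1` such that the edges from a vertex to its successors
carry all distinct labels: `child a l` is the successor `v` of `a` for which the edge from `a` to
`v` has label `l`. -/
structure Labelling where
  /-- the successor along the edge with the given label -/
  child : T.V → Fin q → T.V
  bijOn_child : ∀ a, Set.BijOn (child a) Set.univ {y | T.pred y = a}

open Classical in
/-- The function `f_k[a, φ]` on the tree: its value at `x` is `φ l * q ^ ((hor a - k + 1) / 2)` if
`k > hor a`, `hor x = k` and the `l`-th successor of `a` is an ancestor of `x` (this happens for at
most one `l`), and it is `0` otherwise. -/
noncomputable def levelFun (L : T.Labelling) (a : T.V) (φ : Fin q → ℝ) (k : ℤ) (x : T.V) : ℝ :=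
  ∑ l : Fin q, if T.hor a < k ∧ T.hor x = k ∧ T.Anc (L.child a l) x then
    φ l * (q : ℝ) ^ (((T.hor a - k + 1 : ℤ) : ℝ) / 2) else 0

end HorocyclicTree

/-- The functions `φ_l` on the labels `0, …, q - 1`, used for `l = 1, …, q - 1`. -/
noncomputable def labelFun (q l : ℕ) (s : Fin q) : ℝ :=
  if (s : ℕ) + 1 < l then 0
  else if (s : ℕ) + 1 = l then ((q : ℝ) - l) / √(((q : ℝ) - l) * ((q : ℝ) + 1 - l))
  else -1 / √(((q : ℝ) - l) * ((q : ℝ) + 1 - l))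

/-! ## The simple random walk operator of a graph of bounded degree -/

/-- The vertex degrees of the graph are finite and bounded. -/
def BoundedDegree {V : Type*} (X : SimpleGraph V) : Prop :=
  ∃ C : ℕ, ∀ x, (X.neighborSet x).Finite ∧ (X.neighborSet x).ncard ≤ C

open Classical in
/-- The transition probabilities of simple random walk. -/
noncomputable def srwKernel {V : Type*} (X : SimpleGraph V) (x y : V) : ℝ :=
  if X.Adj x y then 1 / ((X.neighborSet x).ncard : ℝ) else 0

/-- The action of the transition matrix on functions. -/
noncomputable def srwFun {V : Type*} (X : SimpleGraph V) (f : V → ℂ) (x : V) : ℂ :=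
  ∑' y, (srwKernel X x y : ℂ) * f y

theorem srwFun_eq {V : Type*} (X : SimpleGraph V) (x : V) (hx : (X.neighborSet x).Finite)
    (f : V → ℂ) : srwFun X f x =
      ((X.neighborSet x).ncard : ℂ)⁻¹ * ∑ y ∈ hx.toFinset, f y := by
  classical
  unfold srwFun
  rw [tsum_eq_sum (s := hx.toFinset), Finset.mul_sum]
  · refine Finset.sum_congr rfl fun y hy => ?_
    have : X.Adj x y := by simpa using hy
    simp [srwKernel, this]
  · intro y hy
    have : ¬ X.Adj x y := by simpa using hy
    simp [srwKernel, this]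

theorem norm_srwFun_sq_le {V : Type*} (X : SimpleGraph V) (x : V)
    (hx : (X.neighborSet x).Finite) (f : V → ℂ) :
    ‖srwFun X f x‖ ^ 2 ≤ ∑ y ∈ hx.toFinset, ‖f y‖ ^ 2 := by
  rw [srwFun_eq X x hx, Set.ncard_eq_toFinset_card _ hx]
  set s := hx.toFinset
  rcases s.eq_empty_or_nonempty with hs | hs
  · simp [hs]
  have hc : (1 : ℝ) ≤ s.card := by exact_mod_cast hs.card_pos
  have h1 : ‖∑ y ∈ s, f y‖ ^ 2 ≤ s.card * ∑ y ∈ s, ‖f y‖ ^ 2 :=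
    (pow_le_pow_left₀ (norm_nonneg _) (norm_sum_le _ _) 2).trans (sq_sum_le_card_mul_sum_sq)
  have h2 : (0 : ℝ) ≤ ∑ y ∈ s, ‖f y‖ ^ 2 := Finset.sum_nonneg fun _ _ => by positivity
  rw [norm_mul, norm_inv, Complex.norm_natCast, mul_pow, inv_pow, inv_mul_le_iff₀ (by positivity)]
  nlinarith [mul_nonneg (mul_nonneg (by positivity : (0 : ℝ) ≤ s.card) (sub_nonneg.2 hc)) h2]

theorem sum_norm_srwFun_sq_le {V : Type*} (X : SimpleGraph V) (C : ℕ)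
    (hC : ∀ x, (X.neighborSet x).Finite ∧ (X.neighborSet x).ncard ≤ C)
    (f : lp (fun _ : V => ℂ) 2) (s : Finset V) :
    ∑ x ∈ s, ‖srwFun X f x‖ ^ 2 ≤ C * ‖f‖ ^ 2 := by
  classical
  have hle : ∀ u : Finset V, ∑ y ∈ u, ‖f y‖ ^ 2 ≤ ‖f‖ ^ 2 := by
    intro u
    simpa using lp.sum_rpow_le_norm_rpow (p := 2) (by simp) f u
  set N : V → Finset V := fun x => (hC x).1.toFinset with hN
  have hmem : ∀ x y, y ∈ N x ↔ X.Adj x y := fun x y => by simp [hN]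
  calc ∑ x ∈ s, ‖srwFun X f x‖ ^ 2 ≤ ∑ x ∈ s, ∑ y ∈ N x, ‖f y‖ ^ 2 :=
        Finset.sum_le_sum fun x _ => norm_srwFun_sq_le X x _ f
    _ = ∑ y ∈ s.biUnion N, ∑ x ∈ s with X.Adj x y, ‖f y‖ ^ 2 := by
        refine Finset.sum_comm' fun x y => ?_
        simp only [hmem, Finset.mem_filter, Finset.mem_biUnion]
        constructor
        · rintro ⟨h1, h2⟩
          exact ⟨⟨h1, h2⟩, x, h1, h2⟩
        · rintro ⟨h, -⟩
          exact h
    _ ≤ ∑ y ∈ s.biUnion N, C * ‖f y‖ ^ 2 := by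
        refine Finset.sum_le_sum fun y _ => ?_
        rw [Finset.sum_const, nsmul_eq_mul]
        refine mul_le_mul_of_nonneg_right ?_ (by positivity)
        have h1 : (s.filter fun x => X.Adj x y).card ≤ (N y).card :=
          Finset.card_le_card fun x hx => (hmem y x).2 (Finset.mem_filter.1 hx).2.symm
        have h2 : (N y).card ≤ C := by
          exact (Set.ncard_eq_toFinset_card _ (hC y).1).symm.le.trans (hC y).2
        exact_mod_cast h1.trans h2
    _ ≤ C * ‖f‖ ^ 2 := by
        rw [← Finset.mul_sum]
        exact mul_le_mul_of_nonneg_left (hle _) (by positivity)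

theorem memℓp_srwFun {V : Type*} (X : SimpleGraph V) (hX : BoundedDegree X)
    (f : lp (fun _ : V => ℂ) 2) : Memℓp (fun x => srwFun X f x) 2 := by
  obtain ⟨C, hC⟩ := hX
  refine memℓp_gen' (C := C * ‖f‖ ^ 2) fun s => ?_
  simpa using sum_norm_srwFun_sq_le X C hC f s

/-- The simple random walk operator on `ℓ²`, `(P f) x = ∑ y, p x y * f y`. -/
noncomputable def srwOperator {V : Type*} (X : SimpleGraph V) (hX : BoundedDegree X) :
    lp (fun _ : V => ℂ) 2 →L[ℂ] lp (fun _ : V => ℂ) 2 :=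
  LinearMap.mkContinuousOfExistsBound
    { toFun := fun f => ⟨fun x => srwFun X f x, memℓp_srwFun X hX f⟩
      map_add' := fun f g => by
        obtain ⟨C, hC⟩ := hX
        ext x
        change srwFun X (⇑f + ⇑g) x = srwFun X f x + srwFun X g x
        simp [srwFun_eq X x (hC x).1, Finset.sum_add_distrib, mul_add]
      map_smul' := fun c f => by
        obtain ⟨C, hC⟩ := hX
        ext x
        simp [srwFun_eq X x (hC x).1, ← Finset.mul_sum, mul_left_comm] }
    (by
      obtain ⟨C, hC⟩ := hX
      refine ⟨√C, fun f => ?_⟩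
      refine lp.norm_le_of_forall_sum_le (p := 2) (by simp) (by positivity) fun s => ?_
      have := sum_norm_srwFun_sq_le X C hC f s
      simpa [mul_pow] using this)

theorem srwOperator_apply {V : Type*} (X : SimpleGraph V) (hX : BoundedDegree X)
    (f : lp (fun _ : V => ℂ) 2) (x : V) :
    srwOperator X hX f x = ∑' y, (srwKernel X x y : ℂ) * f y := rfl

/-! ## The horocyclic product -/

section DL

variable {d : ℕ} {q : Fin d → ℕ} (T : ∀ j, HorocyclicTree (q j))

/-- The vertices of the horocyclic product of the trees `T 1, …, T d`. -/
abbrev DL : Type _ := {x : ∀ j, (T j).V // ∑ j, (T j).hor (x j) = 0}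

/-- The graph structure of the horocyclic product. -/
def DL.graph : SimpleGraph (DL T) where
  Adj x y := ∃ i j, i ≠ j ∧ (T i).graph.Adj (x.1 i) (y.1 i) ∧ (T j).graph.Adj (x.1 j) (y.1 j) ∧
    ∀ k, k ≠ i → k ≠ j → x.1 k = y.1 k
  symm := ⟨fun _ _ ⟨i, j, hij, h1, h2, h3⟩ =>
    ⟨i, j, hij, h1.symm, h2.symm, fun k hi hj => (h3 k hi hj).symm⟩⟩
  loopless := ⟨fun _ ⟨_, _, _, h1, _⟩ => h1.ne rfl⟩

theorem DL.boundedDegree : BoundedDegree (DL.graph T) := by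
  classical
  have hfin : ∀ j (v : (T j).V), ((T j).graph.neighborSet v).Finite := fun j v =>
    Set.finite_of_ncard_ne_zero (by rw [(T j).ncard_neighborSet]; simp)
  have hcard : ∀ j (v : (T j).V), (hfin j v).toFinset.card = q j + 1 := fun j v => by
    rw [← Set.ncard_eq_toFinset_card _ (hfin j v), (T j).ncard_neighborSet]
  refine ⟨∑ i, ∑ j, (q i + 1) * (q j + 1), fun x => ?_⟩
  let F : Finset (∀ j, (T j).V) := Finset.univ.biUnion fun i => Finset.univ.biUnion fun j =>
    ((hfin i (x.1 i)).toFinset ×ˢ (hfin j (x.1 j)).toFinset).image fun uv =>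
      Function.update (Function.update x.1 i uv.1) j uv.2
  have hsub : Subtype.val '' ((DL.graph T).neighborSet x) ⊆ (F : Set (∀ j, (T j).V)) := by
    rintro _ ⟨y, ⟨i, j, hij, h1, h2, h3⟩, rfl⟩
    simp only [F, Finset.coe_biUnion, Set.mem_iUnion]
    refine ⟨i, by simp, j, by simp, ?_⟩
    simp only [Finset.coe_image, Set.mem_image]
    refine ⟨(y.1 i, y.1 j), by simpa using ⟨h1, h2⟩, ?_⟩
    funext k
    by_cases hkj : k = j
    · subst hkj; simp
    by_cases hki : k = i
    · subst hki; simp [hkj]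
    · simp [hkj, hki, h3 k hki hkj]
  have hinj : Set.InjOn (Subtype.val : DL T → ∀ j, (T j).V) ((DL.graph T).neighborSet x) :=
    Subtype.val_injective.injOn
  refine ⟨Set.Finite.of_finite_image (F.finite_toSet.subset hsub) hinj, ?_⟩
  calc ((DL.graph T).neighborSet x).ncard = (Subtype.val '' ((DL.graph T).neighborSet x)).ncard :=
        hinj.ncard_image.symm
    _ ≤ (F : Set (∀ j, (T j).V)).ncard := Set.ncard_le_ncard hsub F.finite_toSet
    _ = F.card := Set.ncard_coe_finset F
    _ ≤ _ := by
      refine Finset.card_biUnion_le.trans (Finset.sum_le_sum fun i _ => ?_)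
      refine Finset.card_biUnion_le.trans (Finset.sum_le_sum fun j _ => ?_)
      refine Finset.card_image_le.trans ?_
      rw [Finset.card_product, hcard, hcard]

/-- The simple random walk operator on `ℓ²` of the horocyclic product. -/
noncomputable def DL.P : lp (fun _ : DL T => ℂ) 2 →L[ℂ] lp (fun _ : DL T => ℂ) 2 :=
  srwOperator (DL.graph T) (DL.boundedDegree T)

/-- A polyhedron of height at least two in the horocyclic product, given by its vertices
`a 1, …, a d` in the respective trees. -/
structure Polyhedron where
  /-- the vertices of the trees that define the polyhedron -/
  a : ∀ j, (T j).V
  two_le_height : 2 ≤ -∑ j, (T j).hor (a j)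

end DL

/-! ## The simplices and the Dirichlet operators on them -/

section Simplex

/-- The vector `(0, …, 0, -n)`. -/
def corner (d n : ℕ) (j : Fin d) : ℤ := if (j : ℕ) + 1 = d then -n else 0

/-- The simplex `B_n` in the lattice of integer vectors with coordinate sum zero. -/
def simplex (d n : ℕ) : Set (Fin d → ℤ) := {k | ∑ j, k j = 0 ∧ ∀ j, corner d n j ≤ k j}

/-- The boundary of the simplex `B_n`. -/
def simplexBoundary (d n : ℕ) : Set (Fin d → ℤ) := {k ∈ simplex d n | ∃ j, k j = corner d n j}

/-- The interior of the simplex `B_n`. -/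
def simplexInterior (d n : ℕ) : Set (Fin d → ℤ) := simplex d n \ simplexBoundary d n

theorem simplex_finite (d n : ℕ) : (simplex d n).Finite := by
  refine (Set.finite_Icc (corner d n) (fun _ => (d : ℤ) * n)).subset fun k hk => ⟨hk.2, fun i => ?_⟩
  have h0 : ∀ j, -(n : ℤ) ≤ k j := fun j => by
    refine le_trans ?_ (hk.2 j)
    unfold corner
    split_ifs <;> omega
  have h1 := Finset.add_sum_erase Finset.univ k (Finset.mem_univ i)
  have h2 : (Finset.univ.erase i).card • (-(n : ℤ)) ≤ ∑ j ∈ Finset.univ.erase i, k j :=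
    Finset.card_nsmul_le_sum _ _ _ fun j _ => h0 j
  rw [hk.1] at h1
  have h3 : (Finset.univ.erase i).card ≤ d := (Finset.card_le_univ _).trans_eq (Fintype.card_fin d)
  have h4 : ((Finset.univ.erase i).card : ℤ) * n ≤ (d : ℤ) * n := by
    exact_mod_cast Nat.mul_le_mul_right n h3
  simp only [nsmul_eq_mul] at h2
  change k i ≤ (d : ℤ) * n
  linarith

noncomputable instance (d n : ℕ) : Fintype (simplex d n) := (simplex_finite d n).fintype

noncomputable instance (d n : ℕ) : Fintype (simplexInterior d n) :=
  ((simplex_finite d n).subset Set.sdiff_subset).fintype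

/-- The space of functions on `B_n` that vanish on the boundary, with the inner product of
`ℓ²(B_n)`. -/
noncomputable def V0 (d n : ℕ) : Submodule ℂ (EuclideanSpace ℂ (simplex d n)) where
  carrier := {f | ∀ k : simplex d n, (k : Fin d → ℤ) ∈ simplexBoundary d n → f k = 0}
  add_mem' := fun hf hg k hk => by simp [hf k hk, hg k hk]
  zero_mem' := fun _ _ => rfl
  smul_mem' := fun c f hf k hk => by simp [hf k hk]

open Classical in
/-- A function on `B_n` as a function on all integer vectors, with value zero off `B_n`. -/
noncomputable def extendZero {d n : ℕ} (f : EuclideanSpace ℂ (simplex d n)) (k : Fin d → ℤ) : ℂ :=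
  if h : k ∈ simplex d n then f ⟨k, h⟩ else 0

variable {d : ℕ} (q : Fin d → ℕ)

/-- The convolution operator
`Q f k = D⁻¹ * ∑ i, ∑ j ≠ i, √(q i * q j) * f (k + e i - e j)` with
`D = (d - 1) * (q 1 + ⋯ + q d)`. -/
noncomputable def Qfun (f : (Fin d → ℤ) → ℂ) (k : Fin d → ℤ) : ℂ :=
  (1 / (((d : ℂ) - 1) * ∑ i, (q i : ℂ))) *
    ∑ i, ∑ j ∈ Finset.univ.erase i, (√((q i : ℝ) * q j) : ℂ) *
      f (k + Pi.single i 1 - Pi.single j 1)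

open Classical in
/-- The operator `Q_n` on the functions on `B_n` that vanish on the boundary: `Q_n f` is `Q f` in
the interior and zero on the boundary. -/
noncomputable def Qn (n : ℕ) : V0 d n →ₗ[ℂ] V0 d n where
  toFun f := ⟨WithLp.toLp 2 fun k : simplex d n =>
      if (k : Fin d → ℤ) ∈ simplexInterior d n then Qfun q (extendZero f.1) k else 0,
    fun k hk => if_neg fun h => h.2 hk⟩
  map_add' f g := by
    have h : ∀ k, extendZero (f.1 + g.1) k = extendZero f.1 k + extendZero g.1 k := fun k => by
      unfold extendZero
      split_ifs <;> simp
    ext k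
    by_cases hk : (k : Fin d → ℤ) ∈ simplexInterior d n
    · simp only [Qfun, h, hk, if_true, mul_add, Finset.sum_add_distrib, Submodule.coe_add,
        PiLp.add_apply]
    · simp [hk]
  map_smul' c f := by
    have h : ∀ k, extendZero (c • f.1) k = c * extendZero f.1 k := fun k => by
      unfold extendZero
      split_ifs <;> simp
    ext k
    by_cases hk : (k : Fin d → ℤ) ∈ simplexInterior d n
    · simp only [Qfun, h, hk, if_true, Finset.mul_sum, Submodule.coe_smul, PiLp.smul_apply,
        smul_eq_mul, RingHom.id_apply]
      refine Finset.sum_congr rfl fun i _ => Finset.sum_congr rfl fun j _ => ?_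
      ring
    · simp [hk]

end Simplex

/-! ## The functions built from polyhedra -/

namespace Polyhedron

variable {d : ℕ} {q : Fin d → ℕ} {T : ∀ j, HorocyclicTree (q j)} (S : Polyhedron T)

/-- The set of vertices of the polyhedron. -/
def carrier : Set (DL T) := {x | ∀ j, (T j).Anc (S.a j) (x.1 j)}

/-- The height of the polyhedron. -/
noncomputable def height : ℕ := (-∑ j, (T j).hor (S.a j)).toNat

/-- The vector of the horocycle indices of `a 1, …, a d`. -/
noncomputable def h (j : Fin d) : ℤ := (T j).hor (S.a j)

/-- The function `f_k[S, φ 1, …, φ d]` on the horocyclic product. -/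
noncomputable def f (L : ∀ j, (T j).Labelling) (φ : ∀ j, Fin (q j) → ℝ) (k : Fin d → ℤ)
    (x : DL T) : ℝ :=
  ∏ j, (T j).levelFun (L j) (S.a j) (φ j) (k j) (x.1 j)

/-- The function `∑ k, ψ k * f_{k + h + n * e_d}[S, φ 1, …, φ d]` on the horocyclic product, the
sum being over the interior of `B_n`, where `n` is the height of `S`. -/
noncomputable def g (L : ∀ j, (T j).Labelling) (φ : ∀ j, Fin (q j) → ℝ) (ψ : V0 d S.height)
    (x : DL T) : ℂ :=
  ∑ k : simplexInterior d S.height,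
    ψ.1 ⟨k.1, k.2.1⟩ * (S.f L φ (k.1 + S.h - corner d S.height) x : ℂ)

end Polyhedron

/-- The parameters `(S, m, l 1, …, l d)` of the orthonormal basis: a polyhedron `S` of height at
least two, a point `m` of the interior of `B_n` with `n` the height of `S`, and numbers `l j` in
`{1, …, q j - 1}`. -/
abbrev BasisIndex {d : ℕ} {q : Fin d → ℕ} (T : ∀ j, HorocyclicTree (q j)) : Type _ :=
  Σ S : Polyhedron T, simplexInterior d S.height × (∀ j, {l : Fin (q j) // (l : ℕ) ≠ 0})

/-! Fix one tree and one horocycle at level `r`. The functions `levelFun L a (labelFun q l) r`, with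
`a` strictly above that level, are wavelets of Haar type. The `labelFun q l` are orthonormal with
mean zero, and the power of `q` normalises the wavelets, so they are orthonormal
(`tsum_levelFun_labelFun`). They are also complete: a function orthogonal to all of them has equal
descendant sums at siblings, so its sum over the `q ^ n` descendants of the `n`-th ancestor of `x`
is `q ^ n` times its value at `x`. A square-summability bound forces this value to vanish
(`eq_zero_of_tsum_levelFun_mul_eq_zero`). Products of wavelets whose levels sum to zero are
therefore an orthonormal basis of `ℓ²` of the horocyclic product (`inner_fVec_fVec`,
`DL.eq_zero_of_inner_tensor_levelVec_eq_zero`).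

The walk moves to a predecessor in one tree and to a successor in another. On a wavelet, composing
with the predecessor map raises the level by one and summing over successors lowers it by one, each
with a factor `√q`. Hence, for fixed `S` and fixed `l`, the products span an invariant space on
which `P` acts by lattice shifts. Wavelets vanish at the level of `a`, which is exactly the
Dirichlet condition on the simplex, so `P` acts there as the symmetric matrix `Qn` (`P_gMap`).

Diagonalising each `Qn` gives an orthonormal eigenbasis of `P`. Its eigenvalues and its spectrum are
then those of a diagonal operator, and multiplicities are infinite because every height `n ≥ 2` is
attained by infinitely many polyhedra (`exists_height_eq`). -/

namespace HorocyclicTree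

/-! ### Predecessors, common ancestors and the Busemann function -/

variable {q : ℕ} (T : HorocyclicTree q)

theorem adj_iff (x y : T.V) : T.graph.Adj x y ↔ y = T.pred x ∨ x = T.pred y := by
  constructor
  · intro h
    rcases T.pred_of_adj x y h with h | h
    · exact Or.inl h.1
    · exact Or.inr h.1
  · rintro (rfl | rfl)
    · exact T.adj_pred x
    · exact (T.adj_pred y).symm

theorem pred_pred_ne (x : T.V) : T.pred (T.pred x) ≠ x := by
  intro h
  rcases T.pred_of_adj x _ (T.adj_pred x) with h1 | h1
  · exact h1.2 h.symm
  · exact h1.2 rfl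

/-- In a tree the edge from `x` to `pred x` is a bridge, but a closed orbit of minimal length would
join its endpoints the other way round. -/
theorem pred_iterate_ne (x : T.V) {n : ℕ} (hn : 0 < n) : T.pred^[n] x ≠ x := by
  classical
  intro h
  have hex : ∃ n, 0 < n ∧ T.pred^[n] x = x := ⟨n, hn, h⟩
  obtain ⟨hpos, hfix⟩ := Nat.find_spec hex
  have hmin : ∀ i, 0 < i → i < Nat.find hex → T.pred^[i] x ≠ x := fun i h0 hi hx =>
    Nat.find_min hex hi ⟨h0, hx⟩
  set N := Nat.find hex
  have hbr := (SimpleGraph.isAcyclic_iff_forall_adj_isBridge.1 T.isTree.isAcyclic) (T.adj_pred x)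
  rw [SimpleGraph.isBridge_iff] at hbr
  apply hbr
  -- The orbit avoids the removed edge: traversing it would mean an earlier return to `x`, or a
  -- two-cycle of `pred`.
  have key : ∀ i, i + 1 ≤ N →
      (T.graph \ SimpleGraph.fromEdgeSet {s(x, T.pred x)}).Reachable (T.pred x)
        (T.pred^[i + 1] x) := by
    intro i
    induction i with
    | zero => intro _; simp
    | succ i ih =>
      intro hi
      refine (ih (by omega)).trans (SimpleGraph.Adj.reachable ?_)
      rw [SimpleGraph.sdiff_adj]
      refine ⟨by rw [Function.iterate_succ_apply' T.pred (i + 1)]; exact T.adj_pred _, ?_⟩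
      rw [SimpleGraph.fromEdgeSet_adj]
      rintro ⟨h1, -⟩
      rw [Set.mem_singleton_iff, Sym2.eq_iff] at h1
      rcases h1 with ⟨h1, -⟩ | ⟨h1, h2⟩
      · exact hmin (i + 1) (by omega) (by omega) h1
      · rw [Function.iterate_succ_apply' T.pred (i + 1), h1] at h2
        exact T.pred_pred_ne x h2
  have := key (N - 1) (by omega)
  rw [Nat.sub_add_cancel hpos, hfix] at this
  exact this.symm

theorem pred_iterate_injective (x : T.V) : Function.Injective fun n => T.pred^[n] x := by
  have : ∀ m n, m < n → T.pred^[m] x ≠ T.pred^[n] x := by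
    intro m n hmn h
    obtain ⟨k, rfl⟩ := Nat.exists_eq_add_of_lt hmn
    rw [show m + k + 1 = (k + 1) + m by ring, Function.iterate_add_apply] at h
    exact T.pred_iterate_ne _ (Nat.succ_pos k) h.symm
  intro m n h
  rcases lt_trichotomy m n with h1 | h1 | h1
  · exact absurd h (this _ _ h1)
  · exact h1
  · exact absurd h.symm (this _ _ h1)

theorem exists_common_ancestor (x y : T.V) : ∃ m n, T.pred^[m] x = T.pred^[n] y := by
  obtain ⟨w⟩ := T.isTree.connected.preconnected x y
  induction w with
  | nil => exact ⟨0, 0, rfl⟩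
  | @cons u v w h _ ih =>
    obtain ⟨m, n, hmn⟩ := ih
    rcases (T.adj_iff u v).1 h with rfl | rfl
    · exact ⟨m + 1, n, by rw [Function.iterate_succ_apply]; exact hmn⟩
    · refine ⟨m, n + 1, ?_⟩
      rw [Function.iterate_succ_apply', ← hmn, ← Function.iterate_succ_apply' T.pred,
        Function.iterate_succ_apply]

theorem sub_eq_sub_of_iterate_eq {x y : T.V} {m n m' n' : ℕ} (h : T.pred^[m] x = T.pred^[n] y)
    (h' : T.pred^[m'] x = T.pred^[n'] y) : m + n' = m' + n := by
  apply T.pred_iterate_injective x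
  change T.pred^[m + n'] x = T.pred^[m' + n] x
  rw [add_comm m, add_comm m', Function.iterate_add_apply, Function.iterate_add_apply, h, h',
    ← Function.iterate_add_apply, ← Function.iterate_add_apply, add_comm]

/-- The difference of the two step counts is the same for every common ancestor, so the Busemann
function can be read off from any of them, not only from the maximal one. -/
theorem hor_eq_of_iterate_eq {x : T.V} {m n : ℕ} (h : T.pred^[m] x = T.pred^[n] T.root) :
    T.hor x = (m : ℤ) - n := by
  have h1 : T.up x T.root ∈ {m : ℕ | T.Anc (T.pred^[m] x) T.root} := Nat.sInf_mem ⟨m, n, h.symm⟩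
  have h2 : T.up T.root x ∈ {m : ℕ | T.Anc (T.pred^[m] T.root) x} := Nat.sInf_mem ⟨n, m, h⟩
  obtain ⟨N, hN⟩ := h1
  obtain ⟨M, hM⟩ := h2
  have h3 : T.up x T.root ≤ M := Nat.sInf_le ⟨_, hM.symm⟩
  have h4 : T.up T.root x ≤ N := Nat.sInf_le ⟨_, hN.symm⟩
  -- This gives equal sums for the pairs bounded in `h3` and `h4`, so both bounds are equalities.
  have h5 := T.sub_eq_sub_of_iterate_eq hN.symm hM
  have h6 := T.sub_eq_sub_of_iterate_eq h hM
  unfold hor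
  omega

theorem hor_pred (x : T.V) : T.hor (T.pred x) = T.hor x - 1 := by
  obtain ⟨m, n, h⟩ := T.exists_common_ancestor x T.root
  have h1 : T.pred^[m] (T.pred x) = T.pred^[n + 1] T.root := by
    rw [← Function.iterate_succ_apply, Function.iterate_succ_apply', h,
      ← Function.iterate_succ_apply' T.pred]
  rw [T.hor_eq_of_iterate_eq h, T.hor_eq_of_iterate_eq h1]
  push_cast
  ring

theorem hor_pred_iterate (x : T.V) (n : ℕ) : T.hor (T.pred^[n] x) = T.hor x - n := by
  induction n with
  | zero => simp
  | succ n ih => rw [Function.iterate_succ_apply', hor_pred, ih]; push_cast; ring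

theorem hor_root : T.hor T.root = 0 := by
  simpa using T.hor_eq_of_iterate_eq (x := T.root) (m := 0) (n := 0) rfl

theorem Anc.eq_of_hor_eq {T : HorocyclicTree q} {x y : T.V} (h : T.Anc x y)
    (h' : T.hor x = T.hor y) : x = y := by
  obtain ⟨n, rfl⟩ := h
  rw [hor_pred_iterate] at h'
  have : n = 0 := by omega
  simp [this]

theorem anc_refl (x : T.V) : T.Anc x x := ⟨0, rfl⟩

theorem anc_iff_of_hor_lt {x y : T.V} (h : T.hor x < T.hor y) :
    T.Anc x y ↔ T.Anc x (T.pred y) := by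
  constructor
  · rintro ⟨n, rfl⟩
    cases n with
    | zero => simp at h
    | succ n => exact ⟨n, rfl⟩
  · rintro ⟨n, rfl⟩
    exact ⟨n + 1, rfl⟩

/-- Removing the predecessor from the `q + 1` neighbours leaves exactly `q` successors. -/
theorem nonempty_labelling : Nonempty T.Labelling := by
  have hfin : ∀ a, (T.graph.neighborSet a).Finite := fun a =>
    Set.finite_of_ncard_ne_zero (by rw [T.ncard_neighborSet]; simp)
  have hset : ∀ a, T.graph.neighborSet a \ {T.pred a} = {y | T.pred y = a} := by
    intro a
    ext y
    simp only [Set.mem_sdiff, SimpleGraph.mem_neighborSet, adj_iff, Set.mem_singleton_iff,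
      Set.mem_ofPred_eq]
    constructor
    · rintro ⟨h | h, h'⟩
      · exact absurd h h'
      · exact h.symm
    · rintro rfl
      exact ⟨Or.inr rfl, fun h => T.pred_pred_ne y h.symm⟩
  have hcard : ∀ a, ({y | T.pred y = a} : Set T.V).ncard = q := by
    intro a
    rw [← hset, Set.ncard_sdiff_singleton_of_mem ((T.graph.mem_neighborSet a _).2 (T.adj_pred a)), T.ncard_neighborSet]
    simp
  have hf : ∀ a, ({y | T.pred y = a} : Set T.V).Finite := fun a => by
    rw [← hset]
    exact (hfin a).sdiff
  have : ∀ a, Nonempty (Fin q ≃ {y | T.pred y = a}) := by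
    intro a
    have := (hf a).fintype
    refine ⟨(Fintype.equivFinOfCardEq ?_).symm⟩
    rw [← Nat.card_eq_fintype_card]
    exact hcard a
  let e := fun a => (this a).some
  refine ⟨⟨fun a s => (e a s).1, fun a => ⟨fun s _ => (e a s).2, fun s _ s' _ h => ?_, ?_⟩⟩⟩
  · exact (e a).injective (Subtype.ext h)
  · intro y hy
    exact ⟨(e a).symm ⟨y, hy⟩, trivial, by simp⟩

/-! ### Vertices as pairs of a predecessor and a label -/

namespace Labelling

variable {T} (L : T.Labelling)

@[simp] theorem pred_child (a : T.V) (s : Fin q) : T.pred (L.child a s) = a :=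
  (L.bijOn_child a).mapsTo trivial

@[simp] theorem hor_child (a : T.V) (s : Fin q) : T.hor (L.child a s) = T.hor a + 1 := by
  have := T.hor_pred (L.child a s)
  rw [pred_child] at this
  omega

theorem child_inj {a b : T.V} {s t : Fin q} : L.child a s = L.child b t ↔ a = b ∧ s = t := by
  constructor
  · intro h
    have hab : a = b := by simpa using congrArg T.pred h
    subst hab
    exact ⟨rfl, (L.bijOn_child a).injOn trivial trivial h⟩
  · rintro ⟨rfl, rfl⟩
    rfl

theorem exists_child_eq (x : T.V) : ∃ s, L.child (T.pred x) s = x := by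
  obtain ⟨s, -, hs⟩ := (L.bijOn_child (T.pred x)).surjOn (rfl : T.pred x = T.pred x)
  exact ⟨s, hs⟩

/-- A vertex is given by its predecessor and the label of the edge between them. -/
noncomputable def childEquiv : T.V × Fin q ≃ T.V :=
  Equiv.ofBijective (fun p => L.child p.1 p.2)
    ⟨fun _ _ h => Prod.ext (L.child_inj.1 h).1 (L.child_inj.1 h).2, fun x =>
      let ⟨s, hs⟩ := L.exists_child_eq x
      ⟨(T.pred x, s), hs⟩⟩

@[simp] theorem childEquiv_apply (p : T.V × Fin q) : L.childEquiv p = L.child p.1 p.2 := rfl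

/-- Grouping by predecessor is what drives every induction on the level below. -/
theorem tsum_eq_tsum_sum_child {E : Type*} [NormedAddCommGroup E] (F : T.V → E)
    (hF : F.support.Finite) : ∑' x, F x = ∑' z, ∑ s, F (L.child z s) := by
  have hfin : (F ∘ L.childEquiv).support.Finite := by
    rw [Function.support_comp_eq_preimage]
    exact hF.preimage L.childEquiv.injective.injOn
  have hs : Summable fun p : T.V × Fin q => F (L.child p.1 p.2) :=
    summable_of_hasFiniteSupport hfin
  rw [← L.childEquiv.tsum_eq]
  simp only [childEquiv_apply]
  rw [hs.tsum_prod' fun z => (hasSum_fintype _).summable]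
  simp [tsum_fintype]

end Labelling

theorem exists_hor_eq [NeZero q] (r : ℤ) : ∃ x : T.V, T.hor x = r := by
  obtain ⟨L⟩ := T.nonempty_labelling
  rcases le_total 0 r with h | h
  · obtain ⟨n, rfl⟩ := Int.eq_ofNat_of_zero_le h
    clear h
    induction n with
    | zero => exact ⟨T.root, T.hor_root⟩
    | succ n ih =>
      obtain ⟨x, hx⟩ := ih
      exact ⟨L.child x 0, by rw [L.hor_child, hx]; push_cast; ring⟩
  · obtain ⟨n, hn⟩ := Int.eq_ofNat_of_zero_le (neg_nonneg.2 h)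
    exact ⟨T.pred^[n] T.root, by rw [hor_pred_iterate, hor_root]; omega⟩

end HorocyclicTree

/-! ## The functions on the labels -/

section LabelFun

variable {q l : ℕ}

theorem labelFun_eq (hl : 1 ≤ l) (s : Fin q) : labelFun q l s =
    (√(((q : ℝ) - l) * ((q : ℝ) + 1 - l)))⁻¹ *
      ((if s = l - 1 then (q : ℝ) - l else 0) - if l ≤ s then 1 else 0) := by
  unfold labelFun
  rcases lt_trichotomy ((s : ℕ) + 1) l with h | h | h
  · rw [if_pos h, if_neg (by omega), if_neg (by omega)]
    simp
  · rw [if_neg (by omega), if_pos h, if_pos (by omega), if_neg (by omega)]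
    rw [sub_zero, div_eq_inv_mul]
  · rw [if_neg (by omega), if_neg (by omega), if_neg (by omega), if_pos (by omega)]
    rw [div_eq_inv_mul]
    ring

theorem card_filter_le_fin (hl : l ≤ q) :
    ((Finset.univ.filter fun s : Fin q => l ≤ s).card : ℝ) = (q : ℝ) - l := by
  have h : (Finset.univ.filter fun s : Fin q => l ≤ s).card = q - l := by
    rw [← Finset.card_map Fin.valEmbedding]
    have : (Finset.univ.filter fun s : Fin q => l ≤ s).map Fin.valEmbedding = Finset.Ico l q := by
      ext x
      simp only [Finset.mem_map, Finset.mem_filter, Finset.mem_univ, true_and,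
        Fin.valEmbedding_apply, Finset.mem_Ico]
      exact ⟨fun ⟨s, hs, hx⟩ => hx ▸ ⟨hs, s.2⟩, fun ⟨h1, h2⟩ => ⟨⟨x, h2⟩, h1, rfl⟩⟩
    rw [this, Nat.card_Ico]
  rw [h, Nat.cast_sub hl]

theorem sum_labelFun_mul (hl : 1 ≤ l) (hlq : l < q) (F : Fin q → ℝ) :
    ∑ s, labelFun q l s * F s = (√(((q : ℝ) - l) * ((q : ℝ) + 1 - l)))⁻¹ *
      (((q : ℝ) - l) * F ⟨l - 1, by omega⟩ - ∑ s with l ≤ (s : Fin q), F s) := by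
  have h : ∀ s : Fin q, ((s : ℕ) = l - 1) ↔ s = ⟨l - 1, by omega⟩ := fun s => by
    rw [Fin.ext_iff]
  simp only [labelFun_eq hl, mul_assoc, ← Finset.mul_sum, sub_mul, Finset.sum_sub_distrib, ite_mul,
    zero_mul, one_mul, h, Finset.sum_ite_eq', Finset.mem_univ, if_true, Finset.sum_filter]

theorem sum_labelFun (hl : 1 ≤ l) (hlq : l < q) : ∑ s, labelFun q l s = 0 := by
  have := sum_labelFun_mul hl hlq fun _ => 1
  simpa [card_filter_le_fin hlq.le] using this

/-- On the labels where the second function lives the first one is constant, and the second has mean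
zero. -/
theorem sum_labelFun_mul_labelFun_of_lt {l' : ℕ} (h : l < l') (hlq : l' < q) :
    ∑ s, labelFun q l s * labelFun q l' s = 0 := by
  have : ∀ s : Fin q, labelFun q l s * labelFun q l' s =
      -1 / √(((q : ℝ) - l) * ((q : ℝ) + 1 - l)) * labelFun q l' s := by
    intro s
    by_cases hs : (s : ℕ) + 1 < l'
    · simp [labelFun, hs]
    · congr 1
      rw [labelFun, if_neg (by omega), if_neg (by omega)]
  rw [Finset.sum_congr rfl fun s _ => this s, ← Finset.mul_sum, sum_labelFun (by omega) hlq,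
    mul_zero]

theorem sum_labelFun_mul_self (hl : 1 ≤ l) (hlq : l < q) :
    ∑ s, labelFun q l s * labelFun q l s = 1 := by
  have hpos : (0 : ℝ) < (q : ℝ) - l := sub_pos.2 (by exact_mod_cast hlq)
  rw [sum_labelFun_mul hl hlq]
  have h1 : ∀ s ∈ Finset.univ.filter (fun s : Fin q => l ≤ s), labelFun q l s =
      -(√(((q : ℝ) - l) * ((q : ℝ) + 1 - l)))⁻¹ := by
    intro s hs
    have := (Finset.mem_filter.1 hs).2
    rw [labelFun_eq hl, if_neg (by omega), if_pos this]
    ring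
  rw [Finset.sum_congr rfl h1, Finset.sum_const, nsmul_eq_mul, card_filter_le_fin hlq.le,
    labelFun_eq hl, if_pos rfl, if_neg (by simp only []; omega)]
  have hc : (√(((q : ℝ) - l) * ((q : ℝ) + 1 - l)))⁻¹ ^ 2 =
      (((q : ℝ) - l) * ((q : ℝ) + 1 - l))⁻¹ := by
    rw [inv_pow, Real.sq_sqrt]
    nlinarith
  have h2 : ((q : ℝ) + 1 - l) ≠ 0 := by linarith
  calc _ = (√(((q : ℝ) - l) * ((q : ℝ) + 1 - l)))⁻¹ ^ 2 * (((q : ℝ) - l) * ((q : ℝ) + 1 - l)) := by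
        ring
    _ = 1 := by
        rw [hc]
        exact inv_mul_cancel₀ (mul_ne_zero hpos.ne' h2)

theorem sum_labelFun_mul_labelFun {l' : ℕ} (hl : 1 ≤ l) (hl' : 1 ≤ l') (hlq : l < q)
    (hlq' : l' < q) : ∑ s, labelFun q l s * labelFun q l' s = if l = l' then 1 else 0 := by
  rcases lt_trichotomy l l' with h | rfl | h
  · rw [if_neg h.ne, sum_labelFun_mul_labelFun_of_lt h hlq']
  · rw [if_pos rfl, sum_labelFun_mul_self hl hlq]
  · rw [if_neg h.ne', ← sum_labelFun_mul_labelFun_of_lt h hlq]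
    exact Finset.sum_congr rfl fun _ _ => mul_comm _ _

/-- A function on the labels that is orthogonal to all `labelFun q l` is constant. -/
theorem eq_of_sum_labelFun_mul_eq_zero (c : Fin q → ℂ)
    (hc : ∀ l, 1 ≤ l → l < q → ∑ s, (labelFun q l s : ℂ) * c s = 0) (s t : Fin q) : c s = c t := by
  -- Downward induction on `s`: once `c` is constant on the labels after `s`, orthogonality to
  -- `labelFun q (s + 1)` adds the label `s`.
  have key : ∀ n (s t : Fin q), q ≤ s + n → s ≤ t → c s = c t := by
    intro n
    induction n with
    | zero => intro s; omega
    | succ n ih =>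
      intro s t hs hst
      rcases hst.eq_or_lt with rfl | hlt
      · rfl
      have hlt' : (s : ℕ) < t := hlt
      have hl : (s : ℕ) + 1 < q := by omega
      have h := hc (s + 1) (by omega) hl
      have hpos : (0 : ℝ) < (q : ℝ) - (s + 1 : ℕ) := sub_pos.2 (by exact_mod_cast hl)
      have hne : (√(((q : ℝ) - (s + 1 : ℕ)) * ((q : ℝ) + 1 - (s + 1 : ℕ))))⁻¹ ≠ 0 :=
        inv_ne_zero (Real.sqrt_pos.2 (mul_pos hpos (by linarith))).ne'
      have h2 : ∑ r, (labelFun q (s + 1) r : ℂ) * c r =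
          (((√(((q : ℝ) - (s + 1 : ℕ)) * ((q : ℝ) + 1 - (s + 1 : ℕ))))⁻¹ *
            ((q : ℝ) - (s + 1 : ℕ)) : ℝ) : ℂ) * (c s - c t) := by
        -- Replace `c` by the constant `c t`: the labels before `s` carry no weight, and only the
        -- peak at `s` leaves a correction.
        have h3 : ∀ r : Fin q, (labelFun q (s + 1) r : ℂ) * c r =
            (labelFun q (s + 1) r : ℂ) * c t + if r = s then (labelFun q (s + 1) s : ℂ) *
              (c s - c t) else 0 := by
          intro r
          by_cases hr : r = s
          · subst hr; simp only [if_true]; ring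
          rw [if_neg hr, add_zero]
          have hr' : (r : ℕ) ≠ s := fun h => hr (Fin.ext h)
          by_cases hrs : (r : ℕ) < s
          · simp [labelFun, hrs]
          · congr 1
            rw [ih r (max r t) (by omega) (le_max_left _ _),
              ih t (max r t) (by omega) (le_max_right _ _)]
        rw [Finset.sum_congr rfl fun r _ => h3 r, Finset.sum_add_distrib, ← Finset.sum_mul,
          ← Complex.ofReal_sum, sum_labelFun (by omega) hl]
        rw [Finset.sum_ite_eq' Finset.univ s, if_pos (Finset.mem_univ _),
          labelFun_eq (by omega), if_pos (by omega), if_neg (by omega)]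
        simp
      rw [h2, mul_eq_zero, Complex.ofReal_eq_zero] at h
      rcases h with h | h
      · exact absurd h (mul_ne_zero hne hpos.ne')
      · exact sub_eq_zero.1 h
  rcases le_total s t with h | h
  · exact key q s t (by omega) h
  · exact (key q t s (by omega) h).symm

end LabelFun

/-! ### Wavelets on one horocycle: shifts of level and orthonormality -/

namespace HorocyclicTree

variable {q : ℕ} {T : HorocyclicTree q} (L : T.Labelling)

theorem levelFun_of_le {a : T.V} {r : ℤ} (h : r ≤ T.hor a) (φ : Fin q → ℝ) (x : T.V) :
    T.levelFun L a φ r x = 0 :=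
  Finset.sum_eq_zero fun _ _ => if_neg fun h' => absurd h'.1 h.not_gt

theorem levelFun_of_hor_ne {x : T.V} {r : ℤ} (h : T.hor x ≠ r) (a : T.V) (φ : Fin q → ℝ) :
    T.levelFun L a φ r x = 0 :=
  Finset.sum_eq_zero fun _ _ => if_neg fun h' => h h'.2.1

theorem levelFun_eq_zero_of_not_anc {a x : T.V} (h : ¬ T.Anc a x) (φ : Fin q → ℝ) (r : ℤ) :
    T.levelFun L a φ r x = 0 := by
  refine Finset.sum_eq_zero fun l _ => if_neg fun h' => h ?_
  obtain ⟨n, hn⟩ := h'.2.2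
  exact ⟨n + 1, by rw [Function.iterate_succ_apply', hn, L.pred_child]⟩

/-- Below the successors of `a` the function no longer depends on which child is taken; the exponent
drops by one half. -/
theorem levelFun_succ_child (hq : 0 < q) {a : T.V} {r : ℤ} (h : T.hor a < r) (φ : Fin q → ℝ)
    (x : T.V) (s : Fin q) :
    T.levelFun L a φ (r + 1) (L.child x s) = (√q)⁻¹ * T.levelFun L a φ r x := by
  classical
  have hq' : (0 : ℝ) < q := by exact_mod_cast hq
  unfold levelFun
  rw [Finset.mul_sum]
  refine Finset.sum_congr rfl fun l _ => ?_
  rw [mul_ite, mul_zero]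
  refine if_congr ?_ ?_ rfl
  · rw [L.hor_child, add_left_inj]
    refine ⟨fun ⟨_, h2, h3⟩ => ⟨h, h2, ?_⟩, fun ⟨_, h2, h3⟩ => ⟨by omega, h2, ?_⟩⟩
    · rw [T.anc_iff_of_hor_lt (by simp only [L.hor_child]; omega)] at h3
      simpa using h3
    · rw [T.anc_iff_of_hor_lt (by simp only [L.hor_child]; omega)]
      simpa using h3
  · rw [mul_left_comm]
    congr 1
    rw [Real.sqrt_eq_rpow, ← Real.rpow_neg hq'.le, ← Real.rpow_add hq']
    congr 1
    push_cast
    ring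

open Classical in
theorem levelFun_hor_add_one_child (a : T.V) (φ : Fin q → ℝ) (x : T.V) (s : Fin q) :
    T.levelFun L a φ (T.hor a + 1) (L.child x s) = if x = a then φ s else 0 := by
  unfold levelFun
  by_cases hx : x = a
  · subst hx
    rw [if_pos rfl, Finset.sum_eq_single s]
    · rw [if_pos ⟨by omega, L.hor_child _ _, T.anc_refl _⟩]
      simp
    · intro l _ hl
      refine if_neg fun h => hl ?_
      exact (L.child_inj.1 (h.2.2.eq_of_hor_eq (by simp))).2
    · simp
  · rw [if_neg hx]
    refine Finset.sum_eq_zero fun l _ => if_neg fun h => hx ?_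
    have := h.2.2.eq_of_hor_eq (by rw [h.2.1]; simp)
    exact (L.child_inj.1 this).1.symm

/-- The level of `a` is excluded because the function is zero there but need not be zero one level
further down. -/
theorem levelFun_pred (hq : 0 < q) {a : T.V} {r : ℤ} (h : r ≠ T.hor a) (φ : Fin q → ℝ)
    (x : T.V) : T.levelFun L a φ r (T.pred x) = √q * T.levelFun L a φ (r + 1) x := by
  have hq' : (0 : ℝ) < √q := Real.sqrt_pos.2 (by exact_mod_cast hq)
  rcases lt_or_gt_of_ne h with h | h
  · rw [levelFun_of_le L h.le, levelFun_of_le L (by omega), mul_zero]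
  · obtain ⟨s, hs⟩ := L.exists_child_eq x
    conv_rhs => rw [← hs, levelFun_succ_child L hq h, mul_inv_cancel_left₀ hq'.ne']

/-- No level has to be excluded: at `r = hor a + 1` mean zero makes the sum vanish, in agreement
with the zero value at `hor a`. -/
theorem sum_levelFun_child (hq : 0 < q) {φ : Fin q → ℝ} (hφ : ∑ s, φ s = 0) (a : T.V) (r : ℤ)
    (x : T.V) : ∑ s, T.levelFun L a φ r (L.child x s) = √q * T.levelFun L a φ (r - 1) x := by
  obtain ⟨r, rfl⟩ : ∃ r', r = r' + 1 := ⟨r - 1, by ring⟩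
  rw [add_sub_cancel_right]
  rcases lt_trichotomy r (T.hor a) with h | rfl | h
  · simp [levelFun_of_le L h.le, levelFun_of_le L (show r + 1 ≤ T.hor a by omega)]
  · classical
    rw [levelFun_of_le L le_rfl]
    simp only [levelFun_hor_add_one_child]
    by_cases hx : x = a <;> simp [hx, hφ]
  · simp only [levelFun_succ_child L hq h, Finset.sum_const, Finset.card_univ, Fintype.card_fin,
      nsmul_eq_mul, ← mul_assoc]
    congr 1
    have hq' : (0 : ℝ) < √q := Real.sqrt_pos.2 (by exact_mod_cast hq)
    rw [mul_inv_eq_iff_eq_mul₀ hq'.ne', Real.mul_self_sqrt (by positivity)]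

theorem finite_support_levelFun (hq : 0 < q) (a : T.V) (φ : Fin q → ℝ) (r : ℤ) :
    (T.levelFun L a φ r).support.Finite := by
  rcases le_or_gt r (T.hor a) with h | h
  · convert Set.finite_empty
    exact Function.support_eq_empty_iff.2 (funext fun x => levelFun_of_le L h φ x)
  · induction r, h using Int.leInduction with
    | base =>
      refine (Set.finite_range (L.child a)).subset fun x hx => ?_
      obtain ⟨s, hs⟩ := L.exists_child_eq x
      classical
      rw [Function.mem_support, ← hs, levelFun_hor_add_one_child] at hx
      by_cases h : T.pred x = a
      · exact ⟨s, by rw [← h, hs]⟩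
      · exact absurd (if_neg h) hx
    | succ r hr ih =>
      refine ((ih.prod (Set.finite_univ (α := Fin q))).image L.childEquiv).subset fun x hx => ?_
      obtain ⟨s, hs⟩ := L.exists_child_eq x
      refine ⟨(T.pred x, s), ⟨?_, trivial⟩, hs⟩
      rw [Function.mem_support, ← hs, levelFun_succ_child L hq (by omega)] at hx
      exact right_ne_zero_of_mul hx

open Classical in
-- By the normalisation, the sum does not depend on `r`, since each level contributes `q * (√q)⁻¹ ^
-- 2 = 1`. At the first level after `a'` only the successors of `a'` count. If `a` is at a smaller
-- level, its function is constant on them and `φ'` sums to zero.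
theorem tsum_levelFun_mul_levelFun (hq : 0 < q) {φ φ' : Fin q → ℝ} (hφ' : ∑ s, φ' s = 0)
    {a a' : T.V} (haa' : T.hor a ≤ T.hor a') {r : ℤ} (hr : T.hor a' < r) :
    ∑' x, T.levelFun L a φ r x * T.levelFun L a' φ' r x =
      if a = a' then ∑ s, φ s * φ' s else 0 := by
  have hfin : ∀ r, (fun x => T.levelFun L a φ r x * T.levelFun L a' φ' r x).support.Finite :=
    fun r => (finite_support_levelFun L hq a φ r).subset
      (Function.support_mul_subset_left _ _)
  induction r, hr using Int.leInduction with
  | base =>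
    rw [L.tsum_eq_tsum_sum_child _ (hfin _), tsum_eq_single a']
    · rcases haa'.eq_or_lt with h | h
      · simp only [levelFun_hor_add_one_child, if_true]
        rw [← h]
        simp only [levelFun_hor_add_one_child]
        by_cases haa : a = a'
        · simp [haa]
        · simp [haa, Ne.symm haa]
      · have hne : a ≠ a' := fun h' => h.ne (by rw [h'])
        simp only [levelFun_succ_child L hq h, levelFun_hor_add_one_child, if_true]
        rw [← Finset.mul_sum, hφ', mul_zero, if_neg hne]
    · intro z hz
      simp [levelFun_hor_add_one_child, hz]
  | succ r hr ih =>
    rw [L.tsum_eq_tsum_sum_child _ (hfin _), ← ih]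
    congr 1
    funext z
    have hq' : (0 : ℝ) < q := by exact_mod_cast hq
    simp only [levelFun_succ_child L hq (show T.hor a < r by omega),
      levelFun_succ_child L hq (show T.hor a' < r by omega), Finset.sum_const, Finset.card_univ,
      Fintype.card_fin, nsmul_eq_mul]
    have : (√(q : ℝ))⁻¹ * (√(q : ℝ))⁻¹ = (q : ℝ)⁻¹ := by
      rw [← mul_inv, Real.mul_self_sqrt hq'.le]
    calc _ = (q : ℝ) * ((√(q : ℝ))⁻¹ * (√(q : ℝ))⁻¹) *
          (T.levelFun L a φ r z * T.levelFun L a' φ' r z) := by ring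
      _ = _ := by rw [this, mul_inv_cancel₀ hq'.ne', one_mul]

open Classical in
/-- The functions `levelFun L a (labelFun q l) r` on a horocycle are orthonormal. -/
theorem tsum_levelFun_labelFun {l l' : ℕ} (hl : 1 ≤ l) (hl' : 1 ≤ l') (hlq : l < q)
    (hlq' : l' < q) {a a' : T.V} {r : ℤ} (hr : T.hor a < r) (hr' : T.hor a' < r) :
    ∑' x, T.levelFun L a (labelFun q l) r x * T.levelFun L a' (labelFun q l') r x =
      if a = a' ∧ l = l' then 1 else 0 := by
  have hq : 0 < q := by omega
  rw [ite_and]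
  rcases le_total (T.hor a) (T.hor a') with h | h
  · rw [tsum_levelFun_mul_levelFun L hq (sum_labelFun hl' hlq') h hr',
      sum_labelFun_mul_labelFun hl hl' hlq hlq']
  · have := tsum_levelFun_mul_levelFun L hq (φ := labelFun q l') (sum_labelFun hl hlq) h hr
    rw [sum_labelFun_mul_labelFun hl' hl hlq' hlq] at this
    simp only [eq_comm (a := a), eq_comm (a := l)]
    rw [← this]
    exact tsum_congr fun x => mul_comm _ _

/-! ### Completeness of the wavelets on one horocycle -/

namespace Labelling

/-- The sum of a function over the successors of a vertex. -/
noncomputable def childSum (c : T.V → ℂ) (z : T.V) : ℂ := ∑ s, c (L.child z s)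

theorem exists_childSum_iterate_eq (n : ℕ) (b : T.V) : ∃ t : Finset T.V, t.card = q ^ n ∧
    ∀ c, L.childSum^[n] c b = ∑ y ∈ t, c y := by
  induction n with
  | zero => exact ⟨{b}, by simp, by simp⟩
  | succ n ih =>
    obtain ⟨t, ht, h⟩ := ih
    refine ⟨(t ×ˢ Finset.univ).map L.childEquiv.toEmbedding, by simp [ht, pow_succ], fun c => ?_⟩
    rw [Function.iterate_succ_apply, h, Finset.sum_map, Finset.sum_product]
    rfl

/-- Pairing with a wavelet sees `c` only through its sums over the `n`-th generation below each
successor of `a`. -/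
theorem tsum_levelFun_mul (hq : 0 < q) (a : T.V) (φ : Fin q → ℝ) (n : ℕ) (c : T.V → ℂ) :
    ∑' x, (T.levelFun L a φ (T.hor a + 1 + n) x : ℂ) * c x =
      ((√q)⁻¹ : ℂ) ^ n * ∑ s, (φ s : ℂ) * L.childSum^[n] c (L.child a s) := by
  classical
  have hfin : ∀ r (c : T.V → ℂ), (fun x => (T.levelFun L a φ r x : ℂ) * c x).support.Finite := by
    refine fun r c => (finite_support_levelFun L hq a φ r).subset fun x hx => ?_
    have := left_ne_zero_of_mul hx
    exact_mod_cast this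
  induction n generalizing c with
  | zero =>
    rw [L.tsum_eq_tsum_sum_child _ (hfin _ _), tsum_eq_single a]
    · simp [levelFun_hor_add_one_child]
    · intro z hz
      simp [levelFun_hor_add_one_child, hz]
  | succ n ih =>
    rw [L.tsum_eq_tsum_sum_child _ (hfin _ _), Function.iterate_succ_apply, pow_succ', mul_assoc,
      ← ih, ← tsum_mul_left]
    refine tsum_congr fun z => ?_
    rw [childSum, Finset.mul_sum, Finset.mul_sum]
    refine Finset.sum_congr rfl fun s _ => ?_
    rw [show T.hor a + 1 + ((n + 1 : ℕ) : ℤ) = (T.hor a + 1 + n) + 1 by push_cast; ring,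
      levelFun_succ_child L hq (by omega)]
    push_cast
    ring

/-- A function on a horocycle that is orthogonal to all `levelFun L a (labelFun q l) r` vanishes,
if it satisfies a weak form of square summability. -/
theorem eq_zero_of_tsum_levelFun_mul_eq_zero (hq : 2 ≤ q) (c : T.V → ℂ) (C : ℝ)
    (hC : ∀ t : Finset T.V, ‖∑ x ∈ t, c x‖ ^ 2 ≤ C * t.card) (r : ℤ)
    (hc : ∀ a l, T.hor a < r → 1 ≤ l → l < q →
      ∑' x, (T.levelFun L a (labelFun q l) r x : ℂ) * c x = 0)
    (x : T.V) (hx : T.hor x = r) : c x = 0 := by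
  have hq0 : (0 : ℝ) < q := by exact_mod_cast (by omega : 0 < q)
  -- Orthogonality to every `labelFun` at `a` makes the descendant sums of siblings equal.
  have hconst : ∀ n a, T.hor a + 1 + (n : ℕ) = r → ∀ s t,
      L.childSum^[n] c (L.child a s) = L.childSum^[n] c (L.child a t) := by
    intro n a ha
    refine eq_of_sum_labelFun_mul_eq_zero (fun s => L.childSum^[n] c (L.child a s)) ?_
    intro l hl hlq
    have h := hc a l (by omega) hl hlq
    rw [← ha, L.tsum_levelFun_mul (by omega)] at h
    refine (mul_eq_zero.1 h).resolve_left (pow_ne_zero _ (inv_ne_zero ?_))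
    exact_mod_cast (Real.sqrt_pos.2 hq0).ne'
  have hiter : ∀ n : ℕ, L.childSum^[n] c (T.pred^[n] x) = (q : ℂ) ^ n * c x := by
    intro n
    induction n with
    | zero => simp
    | succ n ih =>
      obtain ⟨s, hs⟩ := L.exists_child_eq (T.pred^[n] x)
      rw [Function.iterate_succ_apply', Function.iterate_succ_apply' T.pred, childSum]
      rw [Finset.sum_congr rfl fun t _ => hconst n (T.pred (T.pred^[n] x)) ?_ t s, hs, ih]
      · simp [pow_succ', mul_assoc]
      · rw [T.hor_pred, T.hor_pred_iterate]
        omega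
  -- The sum over `q ^ n` vertices equals `q ^ n * c x`, so `hC` bounds a square of order `q ^ (2 *
  -- n)` by `C * q ^ n`.
  have hbound : ∀ n : ℕ, ‖c x‖ ^ 2 * (q : ℝ) ^ n ≤ C := by
    intro n
    obtain ⟨t, ht, h⟩ := L.exists_childSum_iterate_eq n (T.pred^[n] x)
    have h1 := hC t
    rw [← h, hiter, ht, norm_mul, norm_pow, Complex.norm_natCast] at h1
    push_cast at h1
    have h2 : (0 : ℝ) < (q : ℝ) ^ n := pow_pos hq0 n
    refine le_of_mul_le_mul_right ?_ h2
    calc _ = ((q : ℝ) ^ n * ‖c x‖) ^ 2 := by ring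
      _ ≤ _ := h1
  by_contra hne
  have hpos : 0 < ‖c x‖ ^ 2 := by positivity
  obtain ⟨n, hn⟩ := pow_unbounded_of_one_lt (C / ‖c x‖ ^ 2)
    (show (1 : ℝ) < q by exact_mod_cast (by omega : 1 < q))
  rw [div_lt_iff₀ hpos] at hn
  linarith [hbound n, mul_comm ((q : ℝ) ^ n) (‖c x‖ ^ 2)]

end Labelling

end HorocyclicTree

/-! ## The neighbours in the horocyclic product -/

namespace DL

variable {d : ℕ} {q : Fin d → ℕ} {T : ∀ j, HorocyclicTree (q j)}

/-- Move to the predecessor in the `i`-th tree and to a successor in the `j`-th tree. -/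
noncomputable def move (L : ∀ j, (T j).Labelling) (x : ∀ j, (T j).V)
    (p : Σ _ : Fin d, Σ j : Fin d, Fin (q j)) : ∀ j, (T j).V :=
  Function.update (Function.update x p.1 ((T p.1).pred (x p.1))) p.2.1
    ((L p.2.1).child (x p.2.1) p.2.2)

variable (L : ∀ j, (T j).Labelling)

theorem move_snd (x : ∀ j, (T j).V) (i j : Fin d) (s : Fin (q j)) :
    move L x ⟨i, j, s⟩ j = (L j).child (x j) s := by
  simp [move]

theorem move_fst (x : ∀ j, (T j).V) {i j : Fin d} (hij : i ≠ j) (s : Fin (q j)) :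
    move L x ⟨i, j, s⟩ i = (T i).pred (x i) := by
  simp [move, hij]

theorem move_of_ne (x : ∀ j, (T j).V) {i j k : Fin d} (hi : k ≠ i) (hj : k ≠ j)
    (s : Fin (q j)) : move L x ⟨i, j, s⟩ k = x k := by
  simp [move, hi, hj]

theorem hor_move (x : ∀ j, (T j).V) {i j : Fin d} (hij : i ≠ j) (s : Fin (q j)) (k : Fin d) :
    (T k).hor (move L x ⟨i, j, s⟩ k) - (T k).hor (x k) =
      if k = i then -1 else if k = j then 1 else 0 := by
  by_cases hi : k = i
  · subst hi
    rw [move_fst L x hij, HorocyclicTree.hor_pred, if_pos rfl]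
    ring
  · by_cases hj : k = j
    · subst hj
      rw [move_snd, HorocyclicTree.Labelling.hor_child, if_neg hi, if_pos rfl]
      ring
    · rw [move_of_ne L x hi hj, if_neg hi, if_neg hj, sub_self]

/-- The change of heights is `-1` exactly at `i` and `1` exactly at `j`, which recovers both; the
new `j`-th vertex then recovers the label. -/
theorem injOn_move (x : ∀ j, (T j).V) :
    Set.InjOn (move L x) {p | p.1 ≠ p.2.1} := by
  rintro ⟨i, j, s⟩ hij ⟨i', j', s'⟩ hij' h
  have hij : i ≠ j := hij
  have hij' : i' ≠ j' := hij'
  have h1 := hor_move L x hij s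
  have h2 := hor_move L x hij' s'
  rw [h] at h1
  obtain rfl : i = i' := by
    have h3 := (h1 i).symm.trans (h2 i)
    by_contra hne
    rw [if_pos rfl, if_neg hne] at h3
    split_ifs at h3
  obtain rfl : j = j' := by
    have h3 := (h1 j).symm.trans (h2 j)
    by_contra hne
    rw [if_neg hij.symm, if_pos rfl, if_neg hij.symm, if_neg hne] at h3
    exact one_ne_zero h3
  have h4 := congrFun h j
  rw [move_snd, move_snd, HorocyclicTree.Labelling.child_inj] at h4
  rw [h4.2]

theorem adj_iff_exists_move (x y : DL T) :
    (DL.graph T).Adj x y ↔ ∃ p : Σ _ : Fin d, Σ j : Fin d, Fin (q j),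
      p.1 ≠ p.2.1 ∧ move L x.1 p = y.1 := by
  constructor
  · rintro ⟨i, j, hij, hi, hj, hk⟩
    have hsum : ((T i).hor (y.1 i) - (T i).hor (x.1 i)) +
        ((T j).hor (y.1 j) - (T j).hor (x.1 j)) = 0 := by
      rw [← Fintype.sum_eq_add (f := fun k => (T k).hor (y.1 k) - (T k).hor (x.1 k)) i j hij
        fun k h => by rw [hk k h.1 h.2, sub_self], Finset.sum_sub_distrib, x.2, y.2, sub_self]
    have key : ∀ i j, i ≠ j → y.1 i = (T i).pred (x.1 i) → x.1 j = (T j).pred (y.1 j) →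
        (∀ k, k ≠ i → k ≠ j → x.1 k = y.1 k) →
        ∃ p : Σ _ : Fin d, Σ j : Fin d, Fin (q j), p.1 ≠ p.2.1 ∧ move L x.1 p = y.1 := by
      intro i j hij hi hj hk
      obtain ⟨s, hs⟩ := (L j).exists_child_eq (y.1 j)
      refine ⟨⟨i, j, s⟩, hij, funext fun k => ?_⟩
      by_cases h1 : k = i
      · subst h1
        rw [move_fst L _ hij, hi]
      · by_cases h2 : k = j
        · subst h2
          rw [move_snd, hj, hs]
        · rw [move_of_ne L _ h1 h2, hk k h1 h2]
    -- Moving in the same direction in both trees would change the total height by two.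
    rcases ((T i).adj_iff _ _).1 hi with h1 | h1 <;> rcases ((T j).adj_iff _ _).1 hj with h2 | h2
    · rw [h1, h2, HorocyclicTree.hor_pred, HorocyclicTree.hor_pred] at hsum
      omega
    · exact key i j hij h1 h2 hk
    · exact key j i hij.symm h2 h1 fun k h h' => hk k h' h
    · rw [h1, h2, HorocyclicTree.hor_pred, HorocyclicTree.hor_pred] at hsum
      omega
  · rintro ⟨⟨i, j, s⟩, hij, h⟩
    have hij : i ≠ j := hij
    refine ⟨i, j, hij, ?_, ?_, fun k hi hj => ?_⟩
    · rw [← h, move_fst L _ hij]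
      exact (T i).adj_pred _
    · rw [← h, move_snd, HorocyclicTree.adj_iff]
      exact Or.inr (by simp)
    · rw [← h, move_of_ne L _ hi hj]

theorem sum_hor_move (x : DL T) {i j : Fin d} (hij : i ≠ j) (s : Fin (q j)) :
    ∑ k, (T k).hor (move L x.1 ⟨i, j, s⟩ k) = 0 := by
  have h : ∑ k, ((T k).hor (move L x.1 ⟨i, j, s⟩ k) - (T k).hor (x.1 k)) = 0 := by
    rw [Fintype.sum_eq_add i j hij fun k hk => by
      rw [hor_move L x.1 hij, if_neg hk.1, if_neg hk.2], hor_move L x.1 hij, hor_move L x.1 hij,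
      if_pos rfl, if_neg hij.symm, if_pos rfl]
    rfl
  rwa [Finset.sum_sub_distrib, x.2, sub_zero] at h

/-- `F` is taken on the full product, so that the moves need not carry proofs of membership in `DL
T`. -/
theorem sum_neighborSet (x : DL T) (hx : ((DL.graph T).neighborSet x).Finite)
    (F : (∀ j, (T j).V) → ℂ) : ∑ y ∈ hx.toFinset, F y.1 =
      ∑ i, ∑ j ∈ Finset.univ.erase i, ∑ s, F (move L x.1 ⟨i, j, s⟩) := by
  classical
  have h0 : ∑ y ∈ hx.toFinset, F y.1 =
      ∑ v ∈ hx.toFinset.map ⟨Subtype.val, Subtype.val_injective⟩, F v := by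
    rw [Finset.sum_map]
    rfl
  rw [h0]
  set I : Finset (Σ _ : Fin d, Σ j : Fin d, Fin (q j)) :=
    Finset.univ.sigma fun i => (Finset.univ.erase i).sigma fun j => Finset.univ
  have hI : ∀ p, p ∈ I ↔ p.1 ≠ p.2.1 := by
    intro p
    simp [I, ne_comm]
  have h1 : hx.toFinset.map ⟨Subtype.val, Subtype.val_injective⟩ = I.image (move L x.1) := by
    ext v
    simp only [Finset.mem_map, Set.Finite.mem_toFinset, SimpleGraph.mem_neighborSet,
      Function.Embedding.coeFn_mk, Finset.mem_image, hI]
    constructor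
    · rintro ⟨y, hy, rfl⟩
      exact (adj_iff_exists_move L x y).1 hy
    · rintro ⟨⟨i, j, s⟩, hp, rfl⟩
      exact ⟨⟨_, sum_hor_move L x hp s⟩, (adj_iff_exists_move L x _).2 ⟨_, hp, rfl⟩, rfl⟩
  rw [h1, Finset.sum_image fun p hp p' hp' h => injOn_move L x.1 ((hI p).1 hp) ((hI p').1 hp') h]
  simp only [I, Finset.sum_sigma]

theorem ncard_neighborSet (x : DL T) :
    (((DL.graph T).neighborSet x).ncard : ℂ) = ((d : ℂ) - 1) * ∑ i, (q i : ℂ) := by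
  have hx : ((DL.graph T).neighborSet x).Finite := ((DL.boundedDegree T).choose_spec x).1
  have h := sum_neighborSet (fun j => (T j).nonempty_labelling.some) x hx fun _ => 1
  rw [Finset.sum_const, nsmul_one, ← Set.ncard_eq_toFinset_card _ hx] at h
  rw [h]
  simp only [Finset.sum_const, Finset.card_univ, Fintype.card_fin, mul_one,
    Finset.sum_erase_eq_sub (Finset.mem_univ _), Finset.sum_sub_distrib, nsmul_eq_mul]
  ring

end DL

theorem Fintype.prod_eq_mul_mul_prod_erase {ι M : Type*} [Fintype ι] [DecidableEq ι] [CommMonoid M]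
    {i j : ι} (hij : i ≠ j) (f : ι → M) :
    ∏ k, f k = f j * (f i * ∏ k ∈ (Finset.univ.erase j).erase i, f k) := by
  rw [Finset.mul_prod_erase _ f (Finset.mem_erase.2 ⟨hij, Finset.mem_univ i⟩),
    Finset.mul_prod_erase _ f (Finset.mem_univ j)]

namespace Polyhedron

variable {d : ℕ} {q : Fin d → ℕ} {T : ∀ j, HorocyclicTree (q j)} (S : Polyhedron T)
  (L : ∀ j, (T j).Labelling)

/-- Only the factors `i` and `j` change: the predecessor raises level `i` and the sum over
successors lowers level `j`, giving `√(q i)` and `√(q j)`. -/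
theorem sum_prod_levelFun_move (hq : ∀ j, 0 < q j) {φ : ∀ j, Fin (q j) → ℝ}
    (hφ : ∀ j, ∑ s, φ j s = 0) {r : Fin d → ℤ} (hr : ∀ j, S.h j < r j) {i j : Fin d}
    (hij : i ≠ j) (x : DL T) :
    ∑ s, ∏ k, (T k).levelFun (L k) (S.a k) (φ k) (r k) (DL.move L x.1 ⟨i, j, s⟩ k) =
      √((q i : ℝ) * q j) * S.f L φ (r + Pi.single i 1 - Pi.single j 1) x := by
  have h1 : ∀ s, ∏ k, (T k).levelFun (L k) (S.a k) (φ k) (r k) (DL.move L x.1 ⟨i, j, s⟩ k) =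
      (T j).levelFun (L j) (S.a j) (φ j) (r j) ((L j).child (x.1 j) s) *
        ((T i).levelFun (L i) (S.a i) (φ i) (r i) ((T i).pred (x.1 i)) *
          ∏ k ∈ (Finset.univ.erase j).erase i,
            (T k).levelFun (L k) (S.a k) (φ k) (r k) (x.1 k)) := by
    intro s
    rw [Fintype.prod_eq_mul_mul_prod_erase hij, DL.move_snd, DL.move_fst L _ hij]
    congr 2
    refine Finset.prod_congr rfl fun k hk => ?_
    simp only [Finset.mem_erase] at hk
    rw [DL.move_of_ne L _ hk.1 hk.2.1]
  rw [Finset.sum_congr rfl fun s _ => h1 s, ← Finset.sum_mul,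
    HorocyclicTree.sum_levelFun_child (L j) (hq j) (hφ j),
    HorocyclicTree.levelFun_pred (L i) (hq i) (hr i).ne', f,
    Fintype.prod_eq_mul_mul_prod_erase hij, Real.sqrt_mul (by positivity)]
  have h2 : ∏ k ∈ (Finset.univ.erase j).erase i, (T k).levelFun (L k) (S.a k) (φ k)
      ((r + Pi.single i 1 - Pi.single j 1 : Fin d → ℤ) k) (x.1 k) =
      ∏ k ∈ (Finset.univ.erase j).erase i, (T k).levelFun (L k) (S.a k) (φ k) (r k) (x.1 k) := by
    refine Finset.prod_congr rfl fun k hk => ?_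
    simp only [Finset.mem_erase] at hk
    simp [hk.1, hk.2.1]
  rw [h2]
  simp only [Pi.sub_apply, Pi.add_apply, Pi.single_eq_same, Pi.single_eq_of_ne hij,
    Pi.single_eq_of_ne hij.symm, add_zero, sub_zero]
  ring

theorem srwFun_f (hq : ∀ j, 0 < q j) {φ : ∀ j, Fin (q j) → ℝ} (hφ : ∀ j, ∑ s, φ j s = 0)
    {r : Fin d → ℤ} (hr : ∀ j, S.h j < r j) (x : DL T) :
    srwFun (DL.graph T) (fun x => (S.f L φ r x : ℂ)) x =
      (1 / (((d : ℂ) - 1) * ∑ i, (q i : ℂ))) *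
        ∑ i, ∑ j ∈ Finset.univ.erase i, (√((q i : ℝ) * q j) : ℂ) *
          (S.f L φ (r + Pi.single i 1 - Pi.single j 1) x : ℂ) := by
  have hx : ((DL.graph T).neighborSet x).Finite := ((DL.boundedDegree T).choose_spec x).1
  rw [srwFun_eq _ x hx, DL.ncard_neighborSet, one_div]
  congr 1
  have h := DL.sum_neighborSet L x hx fun v =>
    ((∏ k, (T k).levelFun (L k) (S.a k) (φ k) (r k) (v k) : ℝ) : ℂ)
  refine h.trans (Finset.sum_congr rfl fun i _ => Finset.sum_congr rfl fun j hj => ?_)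
  rw [← Complex.ofReal_sum, S.sum_prod_levelFun_move L hq hφ hr (Finset.ne_of_mem_erase hj).symm]
  push_cast
  rfl

end Polyhedron

/-! ## The spaces `V0` -/

section Simplex

variable {d n : ℕ}

theorem mem_simplexInterior_iff {k : Fin d → ℤ} :
    k ∈ simplexInterior d n ↔ ∑ j, k j = 0 ∧ ∀ j, corner d n j < k j := by
  unfold simplexInterior simplexBoundary simplex
  simp only [Set.mem_sdiff, Set.mem_ofPred_eq, not_and, not_exists]
  constructor
  · rintro ⟨⟨h1, h2⟩, h3⟩
    exact ⟨h1, fun j => lt_of_le_of_ne (h2 j) (Ne.symm (h3 ⟨h1, h2⟩ j))⟩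
  · rintro ⟨h1, h2⟩
    exact ⟨⟨h1, fun j => (h2 j).le⟩, fun _ j => (h2 j).ne'⟩

theorem sum_corner (hd : 0 < d) (n : ℕ) : ∑ j, corner d n j = -n := by
  rw [Finset.sum_eq_single (⟨d - 1, by omega⟩ : Fin d)]
  · simp [corner, Nat.sub_add_cancel hd]
  · intro j _ hj
    refine if_neg fun h => hj (Fin.ext ?_)
    simp only []
    omega
  · simp

theorem V0_apply_eq_zero (f : V0 d n) {k : simplex d n}
    (hk : (k : Fin d → ℤ) ∉ simplexInterior d n) : f.1 k = 0 :=
  f.2 k (by_contra fun h => hk ⟨k.2, h⟩)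

theorem extendZero_eq_zero (f : V0 d n) {k : Fin d → ℤ} (hk : k ∉ simplexInterior d n) :
    extendZero f.1 k = 0 := by
  unfold extendZero
  split_ifs with h
  · exact V0_apply_eq_zero f hk
  · rfl

theorem extendZero_apply (f : V0 d n) (k : simplexInterior d n) :
    extendZero f.1 k = f.1 ⟨k.1, k.2.1⟩ := dif_pos k.2.1

theorem finite_support_extendZero (f : V0 d n) : (extendZero f.1).support.Finite :=
  (Set.toFinite (simplexInterior d n)).subset fun _ hk =>
    by_contra fun h => hk (extendZero_eq_zero f h)

theorem tsum_eq_sum_simplexInterior {E : Type*} [AddCommMonoid E] [TopologicalSpace E] [T2Space E]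
    (F : (Fin d → ℤ) → E) (hF : ∀ k, k ∉ simplexInterior d n → F k = 0) :
    ∑' k, F k = ∑ k : simplexInterior d n, F k := by
  rw [← tsum_fintype (L := .unconditional _), tsum_subtype (simplexInterior d n) F]
  refine tsum_congr fun k => ?_
  by_cases hk : k ∈ simplexInterior d n
  · rw [Set.indicator_of_mem hk]
  · rw [Set.indicator_of_notMem hk, hF k hk]

theorem sum_simplex_eq_sum_simplexInterior {E : Type*} [AddCommMonoid E] (F : simplex d n → E)
    (hF : ∀ k : simplex d n, (k : Fin d → ℤ) ∉ simplexInterior d n → F k = 0) :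
    ∑ k, F k = ∑ k : simplexInterior d n, F ⟨k.1, k.2.1⟩ := by
  symm
  refine Finset.sum_of_injOn (fun k : simplexInterior d n => (⟨k.1, k.2.1⟩ : simplex d n))
    ?_ ?_ ?_ ?_
  · intro k _ k' _ h
    exact Subtype.ext (congrArg (fun x : simplex d n => x.1) h)
  · simp
  · intro k _ hk
    refine hF k fun h => hk ⟨⟨k.1, h⟩, by simp⟩
  · simp

theorem V0_inner_eq (f g : V0 d n) : inner ℂ f g =
    ∑ k : simplexInterior d n, starRingEnd ℂ (extendZero f.1 k) * extendZero g.1 k := by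
  rw [Submodule.coe_inner, PiLp.inner_apply, sum_simplex_eq_sum_simplexInterior]
  · refine Finset.sum_congr rfl fun k _ => ?_
    rw [extendZero_apply, extendZero_apply, RCLike.inner_apply, mul_comm]
  · intro k hk
    rw [V0_apply_eq_zero f hk, inner_zero_left]

/-- A function on the interior of the simplex as an element of `V0`. -/
noncomputable def V0equiv (d n : ℕ) : V0 d n ≃ₗ[ℂ] (simplexInterior d n → ℂ) where
  toFun f k := f.1 ⟨k.1, k.2.1⟩
  map_add' f g := rfl
  map_smul' c f := rfl
  invFun F := by
    classical
    exact ⟨WithLp.toLp 2 fun k => if h : (k : Fin d → ℤ) ∈ simplexInterior d n then F ⟨k, h⟩ else 0,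
      fun k hk => dif_neg fun h => h.2 hk⟩
  left_inv f := by
    ext k
    by_cases hk : (k : Fin d → ℤ) ∈ simplexInterior d n
    · simp [hk]
    · simp [hk, V0_apply_eq_zero f hk]
  right_inv F := by
    ext k
    simp

theorem finrank_V0 (d n : ℕ) : Module.finrank ℂ (V0 d n) = Fintype.card (simplexInterior d n) := by
  rw [(V0equiv d n).finrank_eq, Module.finrank_fintype_fun_eq_card]

/-- `Qfun` as a sum over the lattice, tested against a function: the shifts are moved to the other
factor. -/
theorem tsum_mul_Qfun (q : Fin d → ℕ) (F G : (Fin d → ℤ) → ℂ) (hF : F.support.Finite) :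
    ∑' k, Qfun q F k * G k = ∑' k, F k * Qfun q G k := by
  have hs : ∀ i j : Fin d, Summable fun k : Fin d → ℤ =>
      F (k + Pi.single i 1 - Pi.single j 1) * G k := by
    intro i j
    refine summable_of_hasFiniteSupport ((hF.preimage (f := fun k : Fin d → ℤ =>
      k + Pi.single i 1 - Pi.single j 1) fun k _ k' _ h => ?_).subset fun k hk => ?_)
    · simpa using h
    · exact left_ne_zero_of_mul hk
  have hs' : ∀ i j : Fin d, Summable fun k : Fin d → ℤ =>
      F k * G (k + Pi.single i 1 - Pi.single j 1) := fun i j =>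
    summable_of_hasFiniteSupport (hF.subset fun k hk => left_ne_zero_of_mul hk)
  have hshift : ∀ i j : Fin d, ∑' k, F (k + Pi.single i 1 - Pi.single j 1) * G k =
      ∑' k, F k * G (k + Pi.single j 1 - Pi.single i 1) := by
    intro i j
    rw [← (Equiv.addRight (Pi.single j 1 - Pi.single i 1 : Fin d → ℤ)).tsum_eq]
    refine tsum_congr fun k => ?_
    simp only [Equiv.coe_addRight]
    congr 2 <;> abel
  set D := 1 / (((d : ℂ) - 1) * ∑ i, (q i : ℂ)) with hD
  have hL : ∀ k, Qfun q F k * G k = D * ∑ i, ∑ j ∈ Finset.univ.erase i,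
      (√((q i : ℝ) * q j) : ℂ) * (F (k + Pi.single i 1 - Pi.single j 1) * G k) := by
    intro k
    rw [Qfun, ← hD, mul_assoc, Finset.sum_mul]
    congr 1
    refine Finset.sum_congr rfl fun i _ => ?_
    rw [Finset.sum_mul]
    exact Finset.sum_congr rfl fun j _ => mul_assoc _ _ _
  have hR : ∀ k, F k * Qfun q G k = D * ∑ i, ∑ j ∈ Finset.univ.erase i,
      (√((q i : ℝ) * q j) : ℂ) * (F k * G (k + Pi.single i 1 - Pi.single j 1)) := by
    intro k
    rw [Qfun, ← hD, mul_left_comm, Finset.mul_sum]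
    congr 1
    refine Finset.sum_congr rfl fun i _ => ?_
    rw [Finset.mul_sum]
    exact Finset.sum_congr rfl fun j _ => mul_left_comm _ _ _
  rw [tsum_congr hL, tsum_congr hR, tsum_mul_left, tsum_mul_left]
  congr 1
  rw [Summable.tsum_finsetSum fun i _ => summable_sum fun j _ => (hs i j).mul_left _,
    Summable.tsum_finsetSum fun i _ => summable_sum fun j _ => (hs' i j).mul_left _]
  simp only [Summable.tsum_finsetSum fun j _ => (hs _ j).mul_left _,
    Summable.tsum_finsetSum fun j _ => (hs' _ j).mul_left _, tsum_mul_left, hshift]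
  -- The translation turned `e i - e j` into `e j - e i`; exchanging `i` and `j` undoes this because
  -- the weights are symmetric.
  rw [Finset.sum_comm' (t' := Finset.univ) (s' := fun j => Finset.univ.erase j)
    fun i j => by simp [ne_comm]]
  refine Finset.sum_congr rfl fun i _ => Finset.sum_congr rfl fun j _ => ?_
  rw [mul_comm (q j : ℝ)]

theorem extendZero_Qn (q : Fin d → ℕ) (f : V0 d n) (k : simplexInterior d n) :
    extendZero (Qn q n f).1 k = Qfun q (extendZero f.1) k := by
  rw [extendZero_apply]
  exact if_pos k.2

theorem conj_Qfun (q : Fin d → ℕ) (F : (Fin d → ℤ) → ℂ) (k : Fin d → ℤ) :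
    starRingEnd ℂ (Qfun q F k) = Qfun q (fun k => starRingEnd ℂ (F k)) k := by
  simp [Qfun, map_sum]

/-- Since both functions vanish off the interior, the inner products become lattice sums with the
untruncated operator, whose real weights commute with conjugation. -/
theorem isSymmetric_Qn (q : Fin d → ℕ) (n : ℕ) : 
    LinearMap.IsSymmetric (𝕜 := ℂ) (E := V0 d n) (Qn q n) := by
  intro f g
  rw [V0_inner_eq, V0_inner_eq]
  simp only [extendZero_Qn, conj_Qfun]
  rw [← tsum_eq_sum_simplexInterior (n := n) (fun k =>
      Qfun q (fun k => starRingEnd ℂ (extendZero f.1 k)) k * extendZero g.1 k) fun k hk => by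
        rw [extendZero_eq_zero g hk, mul_zero],
    ← tsum_eq_sum_simplexInterior (n := n) (fun k =>
      starRingEnd ℂ (extendZero f.1 k) * Qfun q (extendZero g.1) k) fun k hk => by
        rw [extendZero_eq_zero f hk, map_zero, zero_mul]]
  refine tsum_mul_Qfun q (fun k => starRingEnd ℂ (extendZero f.1 k)) _
    ((finite_support_extendZero f).subset fun k hk => ?_)
  simpa using hk

theorem exists_orthonormalBasis_eigenvectors_Qn (q : Fin d → ℕ) (n : ℕ) :
    ∃ (ψ : OrthonormalBasis (simplexInterior d n) ℂ (V0 d n)) (ev : simplexInterior d n → ℂ),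
      ∀ m, Qn q n (ψ m) = ev m • ψ m := by
  have hS := isSymmetric_Qn q n
  let e := (Fintype.equivFin (simplexInterior d n)).symm
  refine ⟨(hS.eigenvectorBasis (finrank_V0 d n)).reindex e,
    fun m => hS.eigenvalues (finrank_V0 d n) (e.symm m), fun m => ?_⟩
  rw [OrthonormalBasis.reindex_apply]
  exact hS.apply_eigenvectorBasis _ _

end Simplex

/-! ## Elementary tensors -/

namespace DL

variable {d : ℕ} {q : Fin d → ℕ} {T : ∀ j, HorocyclicTree (q j)}

theorem finite_support_prod (v : ∀ j, (T j).V →₀ ℝ) :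
    (fun x : DL T => ((∏ j, v j (x.1 j) : ℝ) : ℂ)).support.Finite := by
  refine ((Set.Finite.pi' fun j => (v j).hasFiniteSupport).preimage
    (f := (Subtype.val : DL T → ∀ j, (T j).V)) Subtype.val_injective.injOn).subset fun x hx j => ?_
  have h : ∏ j, v j (x.1 j) ≠ 0 := fun h => hx (by simp only [h, Complex.ofReal_zero])
  exact Finset.prod_ne_zero_iff.1 h j (Finset.mem_univ j)

theorem memℓp_of_finite_support {α : Type*} {f : α → ℂ} (hf : f.support.Finite) :
    Memℓp (E := fun _ : α => ℂ) f 2 :=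
  (memℓp_zero (E := fun _ : α => ℂ) (f := f) hf).of_exponent_ge zero_le

/-- The restriction to `DL T` of the product function `x ↦ ∏ j, v j (x j)`. -/
noncomputable def tensor (v : ∀ j, (T j).V →₀ ℝ) : lp (fun _ : DL T => ℂ) 2 :=
  ⟨fun x => ((∏ j, v j (x.1 j) : ℝ) : ℂ), memℓp_of_finite_support (finite_support_prod v)⟩

@[simp] theorem tensor_apply (v : ∀ j, (T j).V →₀ ℝ) (x : DL T) :
    tensor v x = ((∏ j, v j (x.1 j) : ℝ) : ℂ) := rfl

theorem inner_tensor (v w : ∀ j, (T j).V →₀ ℝ) :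
    inner ℂ (tensor v) (tensor w) = ((∑' x : DL T, ∏ j, v j (x.1 j) * w j (x.1 j) : ℝ) : ℂ) := by
  rw [lp.inner_eq_tsum, Complex.ofReal_tsum]
  refine tsum_congr fun x => ?_
  rw [RCLike.inner_apply, tensor_apply, tensor_apply, Complex.conj_ofReal, ← Complex.ofReal_mul,
    Finset.prod_mul_distrib, mul_comm]

/-- When each `v j` lives on a single level and the levels sum to zero, the constraint defining `DL
T` holds on the whole support, so the sum runs over a full product and factors. -/
theorem inner_tensor_eq_prod {v : ∀ j, (T j).V →₀ ℝ} (w : ∀ j, (T j).V →₀ ℝ) {r : Fin d → ℤ}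
    (hr : ∑ j, r j = 0) (hv : ∀ j x, (T j).hor x ≠ r j → v j x = 0) :
    inner ℂ (tensor v) (tensor w) = ((∏ j, ∑' x, v j x * w j x : ℝ) : ℂ) := by
  classical
  rw [inner_tensor]
  congr 1
  have h1 : ∀ j, ∑' x, v j x * w j x = ∑ x ∈ (v j).support, v j x * w j x := fun j =>
    tsum_eq_sum fun x hx => by rw [Finsupp.notMem_support_iff.1 hx, zero_mul]
  simp only [h1]
  rw [Finset.prod_univ_sum]
  have h2 : Function.support (fun x : ∀ j, (T j).V => ∏ j, v j (x j) * w j (x j)) ⊆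
      {x | ∑ j, (T j).hor (x j) = 0} := by
    intro x hx
    have h3 : ∀ j, (T j).hor (x j) = r j := fun j => by
      by_contra hne
      refine hx (Finset.prod_eq_zero (Finset.mem_univ j) ?_)
      rw [hv j _ hne, zero_mul]
    change ∑ j, (T j).hor (x j) = 0
    simp only [h3, hr]
  rw [← tsum_eq_sum (L := .unconditional _)]
  · exact tsum_subtype_eq_of_support_subset h2
  · intro x hx
    rw [Fintype.mem_piFinset, not_forall] at hx
    obtain ⟨j, hj⟩ := hx
    refine Finset.prod_eq_zero (Finset.mem_univ j) ?_
    rw [Finsupp.notMem_support_iff.1 hj, zero_mul]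

/-- Without prescribed levels, dropping the height constraint only adds nonnegative terms. -/
theorem norm_tensor_sq_le (v : ∀ j, (T j).V →₀ ℝ) :
    ‖tensor v‖ ^ 2 ≤ ∏ j, ∑ x ∈ (v j).support, v j x ^ 2 := by
  classical
  have h0 : 0 ≤ ∏ j, ∑ x ∈ (v j).support, v j x ^ 2 :=
    Finset.prod_nonneg fun j _ => Finset.sum_nonneg fun x _ => sq_nonneg _
  rw [← Real.sq_sqrt h0]
  refine pow_le_pow_left₀ (norm_nonneg _) ?_ 2
  refine lp.norm_le_of_forall_sum_le (p := 2) (by simp) (Real.sqrt_nonneg _) fun s => ?_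
  simp only [ENNReal.toReal_ofNat, Real.rpow_two, Real.sq_sqrt h0, tensor_apply,
    Complex.norm_real, Real.norm_eq_abs, sq_abs]
  rw [Finset.prod_univ_sum]
  have h1 : ∑ x ∈ s, (∏ j, v j (x.1 j)) ^ 2 = ∑ x ∈ s.map ⟨Subtype.val, Subtype.val_injective⟩,
      ∏ j, v j (x j) ^ 2 := by
    rw [Finset.sum_map]
    simp [Finset.prod_pow]
  rw [h1, ← Finset.sum_filter_ne_zero]
  refine Finset.sum_le_sum_of_subset_of_nonneg (fun x hx => ?_)
    fun x _ _ => Finset.prod_nonneg fun j _ => sq_nonneg _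
  rw [Fintype.mem_piFinset]
  intro j
  rw [Finsupp.mem_support_iff]
  have := Finset.prod_ne_zero_iff.1 (Finset.mem_filter.1 hx).2 j (Finset.mem_univ j)
  exact pow_ne_zero_iff two_ne_zero |>.1 this

theorem tensor_update_eq_sum (v : ∀ j, (T j).V →₀ ℝ) (j : Fin d) (w : (T j).V →₀ ℝ) :
    tensor (Function.update v j w) =
      ∑ x ∈ w.support, (w x : ℂ) • tensor (Function.update v j (Finsupp.single x 1)) := by
  classical
  ext y
  have h : ∀ u : (T j).V →₀ ℝ, ∏ k, Function.update v j u k (y.1 k) =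
      u (y.1 j) * ∏ k ∈ Finset.univ.erase j, v k (y.1 k) := by
    intro u
    rw [← Finset.mul_prod_erase _ _ (Finset.mem_univ j), Function.update_self]
    congr 1
    refine Finset.prod_congr rfl fun k hk => ?_
    rw [Function.update_of_ne (Finset.ne_of_mem_erase hk)]
  rw [lp.coeFn_sum, Finset.sum_apply]
  simp only [lp.coeFn_smul, Pi.smul_apply, tensor_apply, h, smul_eq_mul, Finsupp.single_apply,
    Complex.ofReal_mul, ite_mul, one_mul, zero_mul]
  rw [Finset.sum_eq_single (y.1 j)]
  · simp
  · intro x _ hx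
    simp [hx]
  · intro hx
    simp [Finsupp.notMem_support_iff.1 hx]

theorem inner_tensor_update (v : ∀ j, (T j).V →₀ ℝ) (j : Fin d) (w : (T j).V →₀ ℝ)
    (u : lp (fun _ : DL T => ℂ) 2) : inner ℂ (tensor (Function.update v j w)) u =
      ∑' x, (w x : ℂ) * inner ℂ (tensor (Function.update v j (Finsupp.single x 1))) u := by
  rw [tsum_eq_sum (s := w.support), tensor_update_eq_sum, sum_inner]
  · refine Finset.sum_congr rfl fun x _ => ?_
    rw [inner_smul_left, Complex.conj_ofReal]
  · intro x hx
    rw [Finsupp.notMem_support_iff.1 hx, Complex.ofReal_zero, zero_mul]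

/-- Cauchy–Schwarz with the indicator of `t` in coordinate `j`. This is the weak square summability
needed for completeness on a single tree. -/
theorem norm_sum_inner_tensor_update_sq_le (v : ∀ j, (T j).V →₀ ℝ) (j : Fin d)
    (u : lp (fun _ : DL T => ℂ) 2) (t : Finset (T j).V) :
    ‖∑ x ∈ t, inner ℂ (tensor (Function.update v j (Finsupp.single x 1))) u‖ ^ 2 ≤
      ((∏ k ∈ Finset.univ.erase j, ∑ x ∈ (v k).support, v k x ^ 2) * ‖u‖ ^ 2) * t.card := by
  classical
  set w : (T j).V →₀ ℝ := Finsupp.indicator t fun _ _ => 1 with hw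
  have hwt : ∀ x, w x = if x ∈ t then 1 else 0 := fun x => by simp [hw, Finsupp.indicator_apply]
  have hsupp : w.support = t := by
    ext x
    simp [hwt]
  have h1 : ∑ x ∈ t, inner ℂ (tensor (Function.update v j (Finsupp.single x 1))) u =
      inner ℂ (tensor (Function.update v j w)) u := by
    rw [tensor_update_eq_sum, sum_inner, hsupp]
    refine Finset.sum_congr rfl fun x hx => ?_
    rw [inner_smul_left, Complex.conj_ofReal, hwt, if_pos hx, Complex.ofReal_one, one_mul]
  rw [h1]
  have h2 := norm_tensor_sq_le (Function.update v j w)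
  rw [← Finset.mul_prod_erase _ _ (Finset.mem_univ j), Function.update_self, hsupp,
    Finset.sum_congr rfl fun x hx => by rw [hwt, if_pos hx, one_pow], Finset.sum_const,
    nsmul_one, Finset.prod_congr rfl fun k hk => by
      rw [Function.update_of_ne (Finset.ne_of_mem_erase hk)]] at h2
  calc _ ≤ (‖tensor (Function.update v j w)‖ * ‖u‖) ^ 2 :=
        pow_le_pow_left₀ (norm_nonneg _) (norm_inner_le_norm _ _) 2
    _ = ‖tensor (Function.update v j w)‖ ^ 2 * ‖u‖ ^ 2 := mul_pow _ _ _
    _ ≤ _ := mul_le_mul_of_nonneg_right h2 (sq_nonneg _)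
    _ = _ := by ring

end DL

/-! ## The functions of a polyhedron -/

namespace HorocyclicTree

variable {q : ℕ} {T : HorocyclicTree q}

/-- The function `levelFun` for one of the functions `labelFun q l`, `l = 1, …, q - 1`. -/
noncomputable def levelVec (L : T.Labelling) (a : T.V) (l : {l : Fin q // (l : ℕ) ≠ 0}) (r : ℤ) :
    T.V →₀ ℝ :=
  Finsupp.ofSupportFinite (T.levelFun L a (labelFun q (l.1 : ℕ)) r)
    (finite_support_levelFun L (by have := l.1.2; omega) a _ r)

@[simp] theorem levelVec_apply (L : T.Labelling) (a : T.V) (l : {l : Fin q // (l : ℕ) ≠ 0})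
    (r : ℤ) (x : T.V) : levelVec L a l r x = T.levelFun L a (labelFun q (l.1 : ℕ)) r x := rfl

open Classical in
theorem tsum_levelVec_mul_levelVec (L : T.Labelling) (l l' : {l : Fin q // (l : ℕ) ≠ 0})
    {a a' : T.V} {r : ℤ} (hr : T.hor a < r) (hr' : T.hor a' < r) :
    ∑' x, levelVec L a l r x * levelVec L a' l' r x = if a = a' ∧ l = l' then 1 else 0 := by
  simp only [levelVec_apply]
  rw [tsum_levelFun_labelFun L (Nat.pos_of_ne_zero l.2) (Nat.pos_of_ne_zero l'.2) l.1.2 l'.1.2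
    hr hr']
  simp only [Subtype.ext_iff, Fin.ext_iff]

end HorocyclicTree

open HorocyclicTree (levelVec)

/-- The functions `levelVec` and point masses can be exchanged one coordinate at a time. -/
theorem DL.eq_zero_of_inner_tensor_levelVec_eq_zero {d : ℕ} {q : Fin d → ℕ}
    {T : ∀ j, HorocyclicTree (q j)} (hq : ∀ j, 2 ≤ q j) (L : ∀ j, (T j).Labelling)
    (u : lp (fun _ : DL T => ℂ) 2)
    (hu : ∀ (a : ∀ j, (T j).V) (l : ∀ j, {l : Fin (q j) // (l : ℕ) ≠ 0}) (r : Fin d → ℤ),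
      ∑ j, r j = 0 → (∀ j, (T j).hor (a j) < r j) →
        inner ℂ (DL.tensor fun j => levelVec (L j) (a j) (l j) (r j)) u = 0) : u = 0 := by
  classical
  ext x
  set r : Fin d → ℤ := fun j => (T j).hor (x.1 j) with hr
  -- Here `s` is the set of coordinates already replaced by point masses. With the other factors
  -- frozen, the pairing is a function on the `j`-th tree, to which completeness there applies.
  have key : ∀ (s : Finset (Fin d)) (a : ∀ j, (T j).V)
      (l : ∀ j, {l : Fin (q j) // (l : ℕ) ≠ 0}), (∀ j, (T j).hor (a j) < r j) →
      inner ℂ (DL.tensor fun j => if j ∈ s then Finsupp.single (x.1 j) 1 else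
        levelVec (L j) (a j) (l j) (r j)) u = 0 := by
    intro s
    induction s using Finset.induction_on with
    | empty => exact fun a l ha => by simpa using hu a l r x.2 ha
    | insert j s hj ih =>
      intro a l ha
      set v : ∀ j, (T j).V →₀ ℝ := fun j => if j ∈ s then Finsupp.single (x.1 j) 1 else
        levelVec (L j) (a j) (l j) (r j) with hv
      have h1 : (fun k => if k ∈ insert j s then Finsupp.single (x.1 k) 1 else
          levelVec (L k) (a k) (l k) (r k)) =
          Function.update v j (Finsupp.single (x.1 j) 1) := by
        funext k
        by_cases hk : k = j
        · subst hk
          simp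
        · simp [hk, hv]
      rw [h1]
      refine (L j).eq_zero_of_tsum_levelFun_mul_eq_zero (hq j)
        (fun y => inner ℂ (DL.tensor (Function.update v j (Finsupp.single y 1))) u) _
        (DL.norm_sum_inner_tensor_update_sq_le v j u) (r j) ?_ (x.1 j) rfl
      intro a' l' ha' hl' hlq'
      have h2 := ih (Function.update a j a') (Function.update l j ⟨⟨l', hlq'⟩, by
        simp only []; omega⟩) fun k => ?_
      · have h3 : (fun k => if k ∈ s then Finsupp.single (x.1 k) 1 else
            levelVec (L k) (Function.update a j a' k) (Function.update l j ⟨⟨l', hlq'⟩, by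
              simp only []; omega⟩ k) (r k)) =
            Function.update v j (levelVec (L j) a' ⟨⟨l', hlq'⟩, by simp only []; omega⟩ (r j)) := by
          funext k
          by_cases hk : k = j
          · subst hk
            simp [hj]
          · simp [hk, hv]
        rw [h3, DL.inner_tensor_update] at h2
        exact h2
      · by_cases hk : k = j
        · subst hk
          simpa using ha'
        · simpa [hk] using ha k
  have hex : ∀ j, Nonempty {l : Fin (q j) // (l : ℕ) ≠ 0} := fun j =>
    ⟨⟨⟨1, hq j⟩, one_ne_zero⟩⟩
  -- With all coordinates replaced, `a` and `l` no longer matter; any admissible choice will do.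
  have h := key Finset.univ (fun j => (T j).pred (x.1 j)) (fun j => (hex j).some) fun j => by
    rw [HorocyclicTree.hor_pred]
    simp [hr]
  have h1 : (DL.tensor fun j => if j ∈ Finset.univ then Finsupp.single (x.1 j) 1 else
        levelVec (L j) ((T j).pred (x.1 j)) (hex j).some (r j)) =
      lp.single (E := fun _ : DL T => ℂ) 2 x 1 := by
    ext y
    rw [DL.tensor_apply, lp.single_apply]
    by_cases hxy : y = x
    · subst hxy
      simp
    · rw [Pi.single_eq_of_ne hxy, Complex.ofReal_eq_zero]
      have : ∃ j, y.1 j ≠ x.1 j := by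
        by_contra! h
        exact hxy (Subtype.ext (funext h))
      obtain ⟨j, hj⟩ := this
      refine Finset.prod_eq_zero (Finset.mem_univ j) ?_
      rw [if_pos (Finset.mem_univ j), Finsupp.single_eq_of_ne hj]
  rw [h1, lp.inner_single_left] at h
  simpa using h

/-! ### The invariant subspace of a polyhedron -/

namespace Polyhedron

variable {d : ℕ} {q : Fin d → ℕ} {T : ∀ j, HorocyclicTree (q j)} (S : Polyhedron T)
  (L : ∀ j, (T j).Labelling)

theorem ext_a {S S' : Polyhedron T} (h : S.a = S'.a) : S = S' := by
  cases S
  cases S'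
  cases h
  rfl

theorem height_eq : (S.height : ℤ) = -∑ j, (T j).hor (S.a j) :=
  Int.toNat_of_nonneg (le_trans (by norm_num) S.two_le_height)

theorem two_le_height' : 2 ≤ S.height := by
  have h := S.two_le_height
  rw [← height_eq] at h
  exact_mod_cast h

/-- The function `f_k[S, φ 1, …, φ d]` for functions `φ j = labelFun (q j) (l j)`, as an element
of `ℓ²`. -/
noncomputable def fVec (l : ∀ j, {l : Fin (q j) // (l : ℕ) ≠ 0}) (r : Fin d → ℤ) :
    lp (fun _ : DL T => ℂ) 2 :=
  DL.tensor fun j => levelVec (L j) (S.a j) (l j) (r j)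

theorem fVec_apply (l : ∀ j, {l : Fin (q j) // (l : ℕ) ≠ 0}) (r : Fin d → ℤ) (x : DL T) :
    S.fVec L l r x = (S.f L (fun j => labelFun (q j) ((l j).1 : ℕ)) r x : ℂ) := rfl

theorem sum_shift (hd : 0 < d) (k : Fin d → ℤ) :
    ∑ j, (k + S.h - corner d S.height) j = ∑ j, k j := by
  have h1 := S.height_eq
  have h2 := sum_corner hd S.height
  simp only [Pi.sub_apply, Pi.add_apply, Finset.sum_sub_distrib, Finset.sum_add_distrib, h]
  omega

theorem h_lt_shift (k : simplexInterior d S.height) (j : Fin d) :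
    S.h j < (k.1 + S.h - corner d S.height) j := by
  have := (mem_simplexInterior_iff.1 k.2).2 j
  simp only [Pi.sub_apply, Pi.add_apply]
  omega

open Classical in
-- Different level vectors give disjoint supports in some coordinate; equal ones reduce to
-- orthonormality in each tree.
theorem inner_fVec_fVec {S S' : Polyhedron T} (l l' : ∀ j, {l : Fin (q j) // (l : ℕ) ≠ 0})
    {r r' : Fin d → ℤ} (hr : ∑ j, r j = 0) (hS : ∀ j, S.h j < r j) (hS' : ∀ j, S'.h j < r' j) :
    inner ℂ (S.fVec L l r) (S'.fVec L l' r') = if (S = S' ∧ l = l') ∧ r = r' then 1 else 0 := by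
  unfold fVec
  rw [DL.inner_tensor_eq_prod _ hr fun j x hx => HorocyclicTree.levelFun_of_hor_ne (L j) hx _ _]
  by_cases hrr : r = r'
  · subst hrr
    rw [Finset.prod_congr rfl fun j _ =>
      HorocyclicTree.tsum_levelVec_mul_levelVec (L j) (l j) (l' j) (hS j) (hS' j)]
    by_cases h : S = S' ∧ l = l'
    · obtain ⟨rfl, rfl⟩ := h
      simp
    · rw [if_neg fun h' => h h'.1, Complex.ofReal_eq_zero]
      have : ∃ j, ¬ (S.a j = S'.a j ∧ l j = l' j) := by
        by_contra! h'
        exact h ⟨ext_a (funext fun j => (h' j).1), funext fun j => (h' j).2⟩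
      obtain ⟨j, hj⟩ := this
      exact Finset.prod_eq_zero (Finset.mem_univ j) (if_neg hj)
  · rw [if_neg fun h' => hrr h'.2, Complex.ofReal_eq_zero]
    obtain ⟨j, hj⟩ := Function.ne_iff.1 hrr
    refine Finset.prod_eq_zero (Finset.mem_univ j) ?_
    rw [← tsum_zero (α := ℝ) (β := (T j).V)]
    refine tsum_congr fun x => ?_
    rw [HorocyclicTree.levelVec_apply, HorocyclicTree.levelVec_apply]
    by_cases hx : (T j).hor x = r j
    · rw [HorocyclicTree.levelFun_of_hor_ne (L j) (r := r' j) (hx ▸ hj), mul_zero]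
    · rw [HorocyclicTree.levelFun_of_hor_ne (L j) hx, zero_mul]

/-- The map `ψ ↦ g[S, φ 1, …, φ d]` for functions `φ j = labelFun (q j) (l j)`. -/
noncomputable def gMap (l : ∀ j, {l : Fin (q j) // (l : ℕ) ≠ 0}) :
    V0 d S.height →ₗ[ℂ] lp (fun _ : DL T => ℂ) 2 :=
  Fintype.linearCombination ℂ (fun k : simplexInterior d S.height =>
    S.fVec L l (k.1 + S.h - corner d S.height)) ∘ₗ (V0equiv d S.height).toLinearMap

theorem gMap_eq_sum (l : ∀ j, {l : Fin (q j) // (l : ℕ) ≠ 0}) (ψ : V0 d S.height) :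
    S.gMap L l ψ = ∑ k : simplexInterior d S.height,
      extendZero ψ.1 k • S.fVec L l (k.1 + S.h - corner d S.height) := by
  simp only [extendZero_apply]
  rfl

theorem gMap_apply (l : ∀ j, {l : Fin (q j) // (l : ℕ) ≠ 0}) (ψ : V0 d S.height) (x : DL T) :
    S.gMap L l ψ x = S.g L (fun j => labelFun (q j) ((l j).1 : ℕ)) ψ x := by
  rw [gMap_eq_sum, lp.coeFn_sum, Finset.sum_apply]
  simp only [extendZero_apply]
  rfl

theorem inner_gMap_gMap (hd : 0 < d) (l : ∀ j, {l : Fin (q j) // (l : ℕ) ≠ 0})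
    (ψ ψ' : V0 d S.height) : inner ℂ (S.gMap L l ψ) (S.gMap L l ψ') = inner ℂ ψ ψ' := by
  classical
  rw [gMap_eq_sum, gMap_eq_sum, sum_inner, V0_inner_eq]
  refine Finset.sum_congr rfl fun k _ => ?_
  rw [inner_smul_left, inner_sum, Finset.sum_eq_single k]
  · rw [inner_smul_right, inner_fVec_fVec L l l ((S.sum_shift hd _).trans k.2.1.1)
      (S.h_lt_shift k) (S.h_lt_shift k), if_pos ⟨⟨rfl, rfl⟩, rfl⟩, mul_one]
  · intro k' _ hk'
    rw [inner_smul_right, inner_fVec_fVec L l l ((S.sum_shift hd _).trans k.2.1.1)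
      (S.h_lt_shift k) (S.h_lt_shift k'), if_neg, mul_zero]
    rintro ⟨-, h⟩
    refine hk' (Subtype.ext ?_)
    simpa using h.symm
  · simp

theorem inner_gMap_gMap_of_ne (hd : 0 < d) {S S' : Polyhedron T}
    {l l' : ∀ j, {l : Fin (q j) // (l : ℕ) ≠ 0}} (h : ¬ (S = S' ∧ l = l')) (ψ : V0 d S.height)
    (ψ' : V0 d S'.height) : inner ℂ (S.gMap L l ψ) (S'.gMap L l' ψ') = 0 := by
  classical
  rw [gMap_eq_sum, gMap_eq_sum, sum_inner]
  refine Finset.sum_eq_zero fun k _ => ?_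
  rw [inner_smul_left, inner_sum, Finset.sum_eq_zero, mul_zero]
  intro k' _
  rw [inner_smul_right, inner_fVec_fVec L l l' ((S.sum_shift hd _).trans k.2.1.1)
    (S.h_lt_shift k) (S'.h_lt_shift k'), if_neg fun h' => h h'.1, mul_zero]

theorem f_eq_zero_of_le (φ : ∀ j, Fin (q j) → ℝ) {r : Fin d → ℤ} {j : Fin d} (h : r j ≤ S.h j)
    (x : DL T) : S.f L φ r x = 0 :=
  Finset.prod_eq_zero (Finset.mem_univ j) (HorocyclicTree.levelFun_of_le (L j) h _ _)

/-- The random walk operator acts on the functions of a polyhedron as `Qn` does on `V0`. -/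
theorem P_gMap (hq : ∀ j, 2 ≤ q j) (l : ∀ j, {l : Fin (q j) // (l : ℕ) ≠ 0})
    (ψ : V0 d S.height) : DL.P T (S.gMap L l ψ) = S.gMap L l (Qn q S.height ψ) := by
  ext x
  set φ : ∀ j, Fin (q j) → ℝ := fun j => labelFun (q j) ((l j).1 : ℕ)
  have hφ : ∀ j, ∑ s, φ j s = 0 := fun j =>
    sum_labelFun (Nat.pos_of_ne_zero (l j).2) (l j).1.2
  set G : (Fin d → ℤ) → ℂ := fun k => (S.f L φ (k + S.h - corner d S.height) x : ℂ) with hG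
  have hP : ∀ k : simplexInterior d S.height,
      DL.P T (S.fVec L l (k.1 + S.h - corner d S.height)) x = Qfun q G k := by
    intro k
    refine (S.srwFun_f L (fun j => by have := hq j; omega) hφ (S.h_lt_shift k) x).trans ?_
    unfold Qfun
    congr 1
    refine Finset.sum_congr rfl fun i _ => Finset.sum_congr rfl fun j _ => ?_
    simp only [hG]
    rw [show k.1 + S.h - corner d S.height + Pi.single i 1 - Pi.single j 1 =
      k.1 + Pi.single i 1 - Pi.single j 1 + S.h - corner d S.height by abel]
  -- Truncating `Q` to the interior costs nothing. If some coordinate inequality fails to be strict,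
  -- `G k` vanishes; otherwise the coordinate sum is nonzero, which shifts preserve, so `Q` sees
  -- only zeros.
  have hG0 : ∀ k, k ∉ simplexInterior d S.height → Qfun q (extendZero ψ.1) k * G k = 0 := by
    intro k hk
    by_cases hlt : ∀ j, corner d S.height j < k j
    · have hsum : ∑ j, k j ≠ 0 := fun h => hk (mem_simplexInterior_iff.2 ⟨h, hlt⟩)
      have hQ : Qfun q (extendZero ψ.1) k = 0 := by
        unfold Qfun
        refine mul_eq_zero_of_right _ (Finset.sum_eq_zero fun i _ => Finset.sum_eq_zero fun j _ => ?_)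
        rw [extendZero_eq_zero ψ, mul_zero]
        intro h
        have := (mem_simplexInterior_iff.1 h).1
        simp [Finset.sum_sub_distrib, Finset.sum_add_distrib] at this
        exact hsum this
      rw [hQ, zero_mul]
    · rw [not_forall] at hlt
      obtain ⟨j, hj⟩ := hlt
      have : G k = 0 := by
        simp only [hG]
        rw [S.f_eq_zero_of_le L φ (j := j), Complex.ofReal_zero]
        simp only [Pi.sub_apply, Pi.add_apply]
        omega
      rw [this, mul_zero]
  have hL : DL.P T (S.gMap L l ψ) x = ∑' k, extendZero ψ.1 k * Qfun q G k := by
    rw [gMap_eq_sum, map_sum, lp.coeFn_sum, Finset.sum_apply,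
      tsum_eq_sum_simplexInterior (n := S.height) _ fun k hk => by
        rw [extendZero_eq_zero ψ hk, zero_mul]]
    refine Finset.sum_congr rfl fun k _ => ?_
    rw [map_smul, lp.coeFn_smul, Pi.smul_apply, hP, smul_eq_mul]
  have hR : S.gMap L l (Qn q S.height ψ) x = ∑' k, Qfun q (extendZero ψ.1) k * G k := by
    rw [gMap_eq_sum, lp.coeFn_sum, Finset.sum_apply,
      tsum_eq_sum_simplexInterior (n := S.height) _ hG0]
    refine Finset.sum_congr rfl fun k _ => ?_
    rw [lp.coeFn_smul, Pi.smul_apply, extendZero_Qn, smul_eq_mul]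
    rfl
  rw [hL, hR, tsum_mul_Qfun q _ _ (finite_support_extendZero ψ)]

theorem support_gMap_subset (l : ∀ j, {l : Fin (q j) // (l : ℕ) ≠ 0}) (ψ : V0 d S.height) :
    Function.support (S.gMap L l ψ : DL T → ℂ) ⊆ S.carrier := by
  intro x hx j
  by_contra h
  refine hx ?_
  rw [gMap_eq_sum, lp.coeFn_sum, Finset.sum_apply]
  refine Finset.sum_eq_zero fun k _ => ?_
  rw [lp.coeFn_smul, Pi.smul_apply, fVec_apply, f,
    Finset.prod_eq_zero (Finset.mem_univ j)
      (HorocyclicTree.levelFun_eq_zero_of_not_anc (L j) h _ _),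
    Complex.ofReal_zero, smul_zero]

theorem finite_support_gMap (l : ∀ j, {l : Fin (q j) // (l : ℕ) ≠ 0}) (ψ : V0 d S.height) :
    (Function.support (S.gMap L l ψ : DL T → ℂ)).Finite := by
  refine (Set.finite_iUnion fun k : simplexInterior d S.height =>
    DL.finite_support_prod fun j => levelVec (L j) (S.a j) (l j)
      ((k.1 + S.h - corner d S.height) j)).subset fun x hx => ?_
  by_contra h
  simp only [Set.mem_iUnion, not_exists, Function.mem_support, not_not] at h
  refine hx ?_
  rw [gMap_eq_sum, lp.coeFn_sum, Finset.sum_apply]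
  refine Finset.sum_eq_zero fun k _ => ?_
  rw [lp.coeFn_smul, Pi.smul_apply]
  exact (congrArg _ (h k)).trans (smul_zero _)

theorem exists_height_eq (hd : 2 ≤ d) (hq : ∀ j, 2 ≤ q j) {n : ℕ} (hn : 2 ≤ n) :
    {S : Polyhedron T | S.height = n}.Infinite := by
  have : ∀ j, NeZero (q j) := fun j => ⟨by have := hq j; omega⟩
  choose y hy using fun (j : Fin d) (r : ℤ) => (T j).exists_hor_eq r
  let i₀ : Fin d := ⟨0, by omega⟩
  let i₁ : Fin d := ⟨1, by omega⟩
  have h01 : i₀ ≠ i₁ := by simp [i₀, i₁]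
  -- For every `t` these levels sum to `-n`, while the level in tree `i₀` recovers `t`.
  let c : ℤ → Fin d → ℤ := fun t => Pi.single i₀ t - Pi.single i₁ (t + n)
  have hc : ∀ t, ∑ j, (T j).hor (y j (c t j)) = -n := fun t => by
    simp [hy, c, Finset.sum_sub_distrib]
  refine Set.infinite_of_injective_forall_mem (f := fun t : ℤ =>
    (⟨fun j => y j (c t j), by rw [hc]; omega⟩ : Polyhedron T)) ?_ ?_
  · intro t t' h
    have h1 := congrFun (congrArg Polyhedron.h h) i₀
    simpa [Polyhedron.h, hy, c, h01] using h1
  · intro t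
    change Int.toNat _ = n
    rw [hc]
    simp

end Polyhedron

/-- The functions `g_m[S, φ 1, …, φ d]` form an orthonormal basis. -/
theorem exists_hilbertBasis_gMap {d : ℕ} (hd : 2 ≤ d) {q : Fin d → ℕ} (hq : ∀ j, 2 ≤ q j)
    {T : ∀ j, HorocyclicTree (q j)} (L : ∀ j, (T j).Labelling)
    (ψ : ∀ n : ℕ, OrthonormalBasis (simplexInterior d n) ℂ (V0 d n)) :
    ∃ b : HilbertBasis (BasisIndex T) ℂ (lp (fun _ : DL T => ℂ) 2),
      ∀ p, b p = p.1.gMap L p.2.2 (ψ p.1.height p.2.1) := by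
  have hd0 : 0 < d := by omega
  have hv : Orthonormal ℂ fun p : BasisIndex T => p.1.gMap L p.2.2 (ψ p.1.height p.2.1) := by
    refine ⟨fun ⟨S, m, l⟩ => ?_, ?_⟩
    · have h1 : ‖S.gMap L l (ψ S.height m)‖ ^ 2 = 1 := by
        classical
        rw [← @inner_self_eq_norm_sq ℂ, S.inner_gMap_gMap L hd0,
          orthonormal_iff_ite.1 (ψ S.height).orthonormal m m, if_pos rfl, RCLike.one_re]
      exact (pow_eq_one_iff_of_nonneg (norm_nonneg _) two_ne_zero).1 h1
    · rintro ⟨S, m, l⟩ ⟨S', m', l'⟩ hne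
      by_cases h : S = S' ∧ l = l'
      · obtain ⟨rfl, rfl⟩ := h
        refine (S.inner_gMap_gMap L hd0 l _ _).trans ((ψ S.height).orthonormal.2 fun h => hne ?_)
        exact congrArg (fun m => (⟨S, m, l⟩ : BasisIndex T)) h
      · exact Polyhedron.inner_gMap_gMap_of_ne L hd0 h _ _
  refine ⟨HilbertBasis.mkOfOrthogonalEqBot hv ?_, fun p => by
    rw [HilbertBasis.coe_mkOfOrthogonalEqBot]⟩
  rw [Submodule.eq_bot_iff]
  intro u hu
  -- As `ψ` is a basis of `V0`, orthogonality to the eigenfunctions extends to the whole image of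
  -- `gMap`, in particular to each single product of wavelets.
  have hg : ∀ (S : Polyhedron T) (l : ∀ j, {l : Fin (q j) // (l : ℕ) ≠ 0}) (f : V0 d S.height),
      inner ℂ u (S.gMap L l f) = 0 := by
    intro S l f
    have h0 : (innerSL ℂ u).toLinearMap ∘ₗ S.gMap L l = 0 := by
      refine (ψ S.height).toBasis.ext fun m => ?_
      have := (Submodule.mem_orthogonal' _ _).1 hu _ (Submodule.subset_span ⟨⟨S, m, l⟩, rfl⟩)
      simpa using this
    exact LinearMap.congr_fun h0 f
  refine DL.eq_zero_of_inner_tensor_levelVec_eq_zero hq L u fun a l r hr ha => ?_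
  -- Each of the `d ≥ 2` level differences is at least one, so every admissible product comes from a
  -- polyhedron of height at least two.
  have hheight : 2 ≤ -∑ j, (T j).hor (a j) := by
    have h1 : ∑ j : Fin d, (1 : ℤ) ≤ ∑ j, (r j - (T j).hor (a j)) :=
      Finset.sum_le_sum fun j _ => by have := ha j; omega
    rw [Finset.sum_sub_distrib, hr] at h1
    simp at h1
    omega
  let S : Polyhedron T := ⟨a, hheight⟩
  let k : simplexInterior d S.height := ⟨r - S.h + corner d S.height, by
    rw [mem_simplexInterior_iff]
    constructor
    · have h1 := S.sum_shift hd0 (r - S.h + corner d S.height)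
      rw [← h1, ← hr]
      refine Finset.sum_congr rfl fun j _ => ?_
      simp only [Pi.sub_apply, Pi.add_apply]
      ring
    · intro j
      have := ha j
      have h2 : S.h j = (T j).hor (a j) := rfl
      simp only [Pi.sub_apply, Pi.add_apply]
      omega⟩
  classical
  have h := hg S l ((V0equiv d S.height).symm (Pi.single k 1))
  rw [Polyhedron.gMap, LinearMap.comp_apply, LinearEquiv.coe_coe, LinearEquiv.apply_symm_apply,
    Fintype.linearCombination_apply_single, one_smul] at h
  have hk : k.1 + S.h - corner d S.height = r := by
    simp only [k]
    abel
  rw [hk] at h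
  exact inner_eq_zero_symm.1 h

/-! ## Operators with an orthonormal basis of eigenvectors -/

section Diagonal

variable {ι H : Type*} [NormedAddCommGroup H] [InnerProductSpace ℂ H]

namespace HilbertBasis

variable (b : HilbertBasis ι ℂ H) (A : H →L[ℂ] H) (ev : ι → ℂ)

/-- Continuity lets `A` act termwise on the expansion of `f`, so self-adjointness is not needed. -/
theorem repr_apply_of_eigenvectors (hA : ∀ i, A (b i) = ev i • b i) (f : H) (i : ι) :
    b.repr (A f) i = ev i * b.repr f i := by
  classical
  have h := ((innerSL ℂ (b i)).hasSum ((A.hasSum (b.hasSum_repr f))))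
  have h' : ∀ j, j ≠ i → innerSL ℂ (b i) (A (b.repr f j • b j)) = 0 := by
    intro j hj
    rw [map_smul, hA, innerSL_apply_apply, inner_smul_right, inner_smul_right,
      b.orthonormal.2 hj.symm]
    simp
  have h2 := (hasSum_single i h').unique h
  rw [b.repr_apply_apply, ← innerSL_apply_apply ℂ, ← h2, map_smul, hA, innerSL_apply_apply,
    inner_smul_right, inner_smul_right, inner_self_eq_norm_sq_to_K, b.orthonormal.1]
  simp [mul_comm]

theorem hasEigenvalue_iff_of_eigenvectors (hA : ∀ i, A (b i) = ev i • b i) (μ : ℂ) :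
    Module.End.HasEigenvalue A.toLinearMap μ ↔ ∃ i, ev i = μ := by
  constructor
  · intro h
    obtain ⟨f, hf⟩ := h.exists_hasEigenvector
    by_contra! hne
    refine hf.2 (b.repr.injective (lp.ext (funext fun i => ?_)))
    have h1 := b.repr_apply_of_eigenvectors A ev hA f i
    have h2 : A f = μ • f := hf.apply_eq_smul
    rw [h2] at h1
    simp only [map_smul, lp.coeFn_smul, Pi.smul_apply, smul_eq_mul] at h1
    have h3 : (μ - ev i) * b.repr f i = 0 := by linear_combination h1
    simpa using (mul_eq_zero.1 h3).resolve_left (sub_ne_zero.2 (hne i).symm)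
  · rintro ⟨i, rfl⟩
    refine Module.End.hasEigenvalue_of_hasEigenvector (x := b i) ⟨?_, b.orthonormal.ne_zero i⟩
    exact Module.End.mem_eigenspace_iff.2 (hA i)

/-- At distance `δ > 0` from all eigenvalues, Parseval bounds `μ - A` below by `δ`. Its range is
then closed and contains every basis vector, so it is bijective. Conversely, the spectrum is closed
and contains the eigenvalues. -/
theorem spectrum_eq_closure_of_eigenvectors [CompleteSpace H]
    (hA : ∀ i, A (b i) = ev i • b i) : spectrum ℂ A = closure (Set.range ev) := by
  classical
  apply Set.Subset.antisymm
  · intro μ hμ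
    by_contra hcl
    apply hμ
    obtain ⟨δ, hδ, hball⟩ := Metric.isOpen_iff.1 isClosed_closure.isOpen_compl μ hcl
    have hdist : ∀ i, δ ≤ ‖μ - ev i‖ := by
      intro i
      by_contra! hlt
      refine hball (a := ev i) ?_ (subset_closure ⟨i, rfl⟩)
      rwa [Metric.mem_ball, dist_eq_norm, norm_sub_rev]
    set B : H →L[ℂ] H := algebraMap ℂ (H →L[ℂ] H) μ - A with hB
    have hBb : ∀ i, B (b i) = (μ - ev i) • b i := by
      intro i
      rw [hB, sub_apply, hA, sub_smul]
      simp [Algebra.algebraMap_eq_smul_one]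
    have hrepr := b.repr_apply_of_eigenvectors B _ hBb
    have hbelow : ∀ f, δ * ‖f‖ ≤ ‖B f‖ := by
      intro f
      rw [← b.repr.norm_map f, ← b.repr.norm_map (B f)]
      refine le_of_sq_le_sq ?_ (norm_nonneg _)
      have hsq : ∀ g : lp (fun _ : ι => ℂ) 2, HasSum (fun i => ‖g i‖ ^ 2) (‖g‖ ^ 2) := by
        intro g
        have := lp.hasSum_norm (p := 2) (by simp) g
        simpa using this
      rw [mul_pow]
      refine hasSum_le (fun i => ?_) ((hsq (b.repr f)).mul_left (δ ^ 2)) (hsq (b.repr (B f)))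
      rw [hrepr, norm_mul, mul_pow]
      gcongr
      exact hdist i
    have hanti : AntilipschitzWith (⟨δ⁻¹, (inv_pos.2 hδ).le⟩ : NNReal) B := by
      refine AddMonoidHomClass.antilipschitz_of_bound B fun f => ?_
      change ‖f‖ ≤ δ⁻¹ * ‖B f‖
      rw [le_inv_mul_iff₀ hδ]
      exact hbelow f
    have hclosed : IsClosed (Set.range B) := hanti.isClosed_range B.uniformContinuous
    have hrange : LinearMap.range B.toLinearMap = ⊤ := by
      have h1 : Submodule.span ℂ (Set.range b) ≤ LinearMap.range B.toLinearMap := by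
        rw [Submodule.span_le]
        rintro _ ⟨i, rfl⟩
        have hne : μ - ev i ≠ 0 := norm_pos_iff.1 (hδ.trans_le (hdist i))
        refine ⟨(μ - ev i)⁻¹ • b i, ?_⟩
        rw [ContinuousLinearMap.coe_coe, map_smul, hBb, smul_smul, inv_mul_cancel₀ hne, one_smul]
      rw [eq_top_iff, ← b.dense_span]
      refine Submodule.topologicalClosure_minimal _ h1 ?_
      rw [LinearMap.coe_range]
      exact hclosed
    rw [spectrum.mem_resolventSet_iff, ← hB, ContinuousLinearMap.isUnit_iff_bijective]
    exact ⟨hanti.injective, LinearMap.range_eq_top.1 hrange⟩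
  · refine closure_minimal ?_ (spectrum.isClosed A)
    rintro _ ⟨i, rfl⟩
    have h := (b.hasEigenvalue_iff_of_eigenvectors A ev hA (ev i)).2 ⟨i, rfl⟩
    rw [spectrum.mem_iff]
    intro hu
    rw [ContinuousLinearMap.isUnit_iff_bijective] at hu
    apply b.orthonormal.ne_zero i
    apply hu.1
    rw [map_zero, sub_apply, hA]
    simp [Algebra.algebraMap_eq_smul_one]

theorem not_finiteDimensional_eigenspace (hA : ∀ i, A (b i) = ev i • b i) (μ : ℂ)
    (h : {i | ev i = μ}.Infinite) :
    ¬ FiniteDimensional ℂ (Module.End.eigenspace A.toLinearMap μ) := by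
  intro hfin
  have : Infinite {i | ev i = μ} := h.to_subtype
  let v : {i | ev i = μ} → Module.End.eigenspace A.toLinearMap μ := fun i =>
    ⟨b i, Module.End.mem_eigenspace_iff.2 ((hA i).trans (congrArg (· • b i) i.2))⟩
  have hv : LinearIndependent ℂ v := by
    refine LinearIndependent.of_comp (Submodule.subtype _) ?_
    exact (b.orthonormal.linearIndependent).comp _ Subtype.val_injective
  exact not_finite_iff_infinite.2 ‹_› hv.finite

end HilbertBasis

theorem OrthonormalBasis.spectrum_eq_range_of_eigenvectors [Fintype ι] [FiniteDimensional ℂ H]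
    (b : OrthonormalBasis ι ℂ H) (A : Module.End ℂ H) (ev : ι → ℂ)
    (hA : ∀ i, A (b i) = ev i • b i) : spectrum ℂ A = Set.range ev := by
  ext μ
  rw [← Module.End.hasEigenvalue_iff_mem_spectrum]
  refine (b.toHilbertBasis.hasEigenvalue_iff_of_eigenvectors (LinearMap.toContinuousLinearMap A) ev
    (fun i => ?_) μ)
  simpa using hA i

end Diagonal

/-- The eigenvalues of `Qn` are those of an orthonormal basis of eigenvectors. -/
theorem iUnion_spectrum_Qn {d : ℕ} (q : Fin d → ℕ)
    (ψ : ∀ n : ℕ, OrthonormalBasis (simplexInterior d n) ℂ (V0 d n))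
    (ev : ∀ n : ℕ, simplexInterior d n → ℂ)
    (hψ : ∀ n ≥ 2, ∀ m, Qn q n (ψ n m) = ev n m • ψ n m) :
    ⋃ n ≥ 2, spectrum ℂ (Qn q n : Module.End ℂ (V0 d n)) = {μ | ∃ n ≥ 2, ∃ m, ev n m = μ} := by
  ext μ
  simp only [Set.mem_iUnion, exists_prop, Set.mem_ofPred_eq]
  refine exists_congr fun n => and_congr_right fun hn => ?_
  have h := (ψ n).spectrum_eq_range_of_eigenvectors (Qn q n) (ev n) (hψ n hn)
  exact Iff.of_eq (congrArg (μ ∈ ·) h)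

/-! ### The spectrum of the random walk operator -/

theorem theorem5p10 {d : ℕ} (hd : 2 ≤ d) (q : Fin d → ℕ) (hq : ∀ j, 2 ≤ q j)
    (T : ∀ j, HorocyclicTree (q j)) :
    spectrum ℂ (DL.P T) = closure (⋃ n ≥ 2, spectrum ℂ (Qn q n : Module.End ℂ (V0 d n))) ∧
    {μ : ℂ | Module.End.HasEigenvalue (DL.P T).toLinearMap μ} =
      ⋃ n ≥ 2, spectrum ℂ (Qn q n : Module.End ℂ (V0 d n)) ∧
    (∀ μ : ℂ, Module.End.HasEigenvalue (DL.P T).toLinearMap μ →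
      ¬ FiniteDimensional ℂ (Module.End.eigenspace (DL.P T).toLinearMap μ)) ∧
    (∀ j, Nonempty (T j).Labelling) ∧
    (∃ (ψ : ∀ n : ℕ, OrthonormalBasis (simplexInterior d n) ℂ (V0 d n))
      (ev : ∀ n : ℕ, simplexInterior d n → ℂ), ∀ n ≥ 2, ∀ m, Qn q n (ψ n m) = ev n m • ψ n m) ∧
    ∀ (L : ∀ j, (T j).Labelling)
      (ψ : ∀ n : ℕ, OrthonormalBasis (simplexInterior d n) ℂ (V0 d n))
      (ev : ∀ n : ℕ, simplexInterior d n → ℂ),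
      (∀ n ≥ 2, ∀ m, Qn q n (ψ n m) = ev n m • ψ n m) →
      {μ : ℂ | Module.End.HasEigenvalue (DL.P T).toLinearMap μ} =
        {μ : ℂ | ∃ n ≥ 2, ∃ m, ev n m = μ} ∧
      ∃ b : HilbertBasis (BasisIndex T) ℂ (lp (fun _ : DL T => ℂ) 2),
        ∀ (S : Polyhedron T) (m : simplexInterior d S.height)
          (l : ∀ j, {l : Fin (q j) // (l : ℕ) ≠ 0}),
          (∀ x, b ⟨S, m, l⟩ x =
            S.g L (fun j => labelFun (q j) ((l j).1 : ℕ)) (ψ S.height m) x) ∧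
          DL.P T (b ⟨S, m, l⟩) = ev S.height m • b ⟨S, m, l⟩ ∧
          Function.support (b ⟨S, m, l⟩ : DL T → ℂ) ⊆ S.carrier ∧
          (Function.support (b ⟨S, m, l⟩ : DL T → ℂ)).Finite := by
  classical
  have : ∀ j, NeZero (q j) := fun j => ⟨by have := hq j; omega⟩
  have hl : Nonempty (∀ j, {l : Fin (q j) // (l : ℕ) ≠ 0}) :=
    ⟨fun j => ⟨⟨1, hq j⟩, one_ne_zero⟩⟩
  have hL : ∀ j, Nonempty (T j).Labelling := fun j => (T j).nonempty_labelling
  have main : ∀ (L : ∀ j, (T j).Labelling)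
      (ψ : ∀ n : ℕ, OrthonormalBasis (simplexInterior d n) ℂ (V0 d n))
      (ev : ∀ n : ℕ, simplexInterior d n → ℂ),
      (∀ n ≥ 2, ∀ m, Qn q n (ψ n m) = ev n m • ψ n m) →
      ∃ b : HilbertBasis (BasisIndex T) ℂ (lp (fun _ : DL T => ℂ) 2),
        (∀ p, b p = p.1.gMap L p.2.2 (ψ p.1.height p.2.1)) ∧
        (∀ p, DL.P T (b p) = ev p.1.height p.2.1 • b p) ∧
        Set.range (fun p : BasisIndex T => ev p.1.height p.2.1) =
          {μ | ∃ n ≥ 2, ∃ m, ev n m = μ} := by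
    intro L ψ ev hψ
    obtain ⟨b, hb⟩ := exists_hilbertBasis_gMap hd hq L ψ
    refine ⟨b, hb, fun p => ?_, ?_⟩
    · rw [hb, p.1.P_gMap L hq, hψ _ p.1.two_le_height', map_smul]
    · ext μ
      constructor
      · rintro ⟨p, rfl⟩
        exact ⟨_, p.1.two_le_height', _, rfl⟩
      · rintro ⟨n, hn, m, rfl⟩
        obtain ⟨S, rfl⟩ := (Polyhedron.exists_height_eq (T := T) hd hq hn).nonempty
        exact ⟨⟨S, m, hl.some⟩, rfl⟩
  choose ψ ev hψ using exists_orthonormalBasis_eigenvectors_Qn q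
  obtain ⟨b, -, hP, hrange⟩ := main (fun j => (hL j).some) ψ ev fun n _ => hψ n
  have hunion := iUnion_spectrum_Qn q ψ ev fun n _ => hψ n
  refine ⟨?_, ?_, fun μ hμ => ?_, hL, ⟨ψ, ev, fun n _ => hψ n⟩, fun L ψ ev hψ => ?_⟩
  · rw [hunion, ← hrange]
    exact b.spectrum_eq_closure_of_eigenvectors _ _ hP
  · rw [hunion, ← hrange]
    ext μ
    exact b.hasEigenvalue_iff_of_eigenvectors _ _ hP μ
  · obtain ⟨⟨S₀, m, l⟩, rfl⟩ := (b.hasEigenvalue_iff_of_eigenvectors _ _ hP μ).1 hμ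
    refine b.not_finiteDimensional_eigenspace _ _ hP _ ?_
    -- An eigenvalue depends on the polyhedron only through its height, and infinitely many
    -- polyhedra share the height of `S₀`.
    refine Set.Infinite.of_image (fun p : BasisIndex T => p.1)
      ((Polyhedron.exists_height_eq (T := T) hd hq S₀.two_le_height').mono ?_)
    intro S hS
    -- The type of `m` depends on the height, so it is transported along the equality of heights.
    have : ∀ (n : ℕ) (h : S.height = n) (m : simplexInterior d n),
        ∃ m' : simplexInterior d S.height, ev S.height m' = ev n m := by
      rintro _ rfl m
      exact ⟨m, rfl⟩
    obtain ⟨m', hm'⟩ := this _ hS m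
    exact ⟨⟨S, m', l⟩, hm', rfl⟩
  · obtain ⟨b, hb, hP, hrange⟩ := main L ψ ev hψ
    refine ⟨?_, b, fun S m l => ⟨fun x => ?_, hP ⟨S, m, l⟩, ?_, ?_⟩⟩
    · rw [← hrange]
      ext μ
      exact b.hasEigenvalue_iff_of_eigenvectors _ _ hP μ
    · rw [hb]
      exact S.gMap_apply L l _ x
    · rw [hb]
      exact S.support_gMap_subset L l _
    · rw [hb]
      exact S.finite_support_gMap L l _
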